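/- **Conventions.** Let $\mathcal C,\mathcal D$ be monoidal categories; associativity and unit constraints are suppressed below. A *linearly distributive functor* $(R,L):\mathcal C\to\mathcal D$ consists of a monoidal functor $(R,r_2:RX\otimes RY\to R(X\otimes Y),\,r_0:\mathbb 1\to R\mathbb 1)$, a comonoidal functor $(L,L_2:L(X\otimes Y)\to LX\otimes LY,\,L_0:L\mathbb 1\to\mathbb 1)$ and natural transformations (strengths and costrengths) $$\nu_R^r:R(X\otimes Y)\to LX\otimes RY,\quad \nu_R^l:R(X\otimes Y)\to RX\otimes LY,\quad \nu_L^r:RX\otimes LY\to L(X\otimes Y),\quad \nu_L^l:LX\otimes RY\to L(X\otimes Y)$$ such that 1. $\nu_L^l(1\otimes r_0)=1$, $\ \nu_L^r(r_0\otimes 1)=1$, $\ (1\otimes L_0)\nu_R^l=1$, $\ (L_0\otimes 1)\nu_R^r=1$; 2. $\nu_L^l(\nu_L^l\otimes 1)=\nu_L^l(1\otimes r_2)$, $\ \nu_L^r(1\otimes\nu_L^r)=\nu_L^r(r_2\otimes 1)$, $\ (\nu_R^l\otimes 1)\nu_R^l=(1\otimes L_2)\nu_R^l$, $\ (1\otimes\nu_R^r)\nu_R^r=(L_2\otimes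 1)\nu_R^r$; 3. $\nu_L^r(1\otimes\nu_L^l)=\nu_L^l(\nu_L^r\otimes 1)$, $\ (1\otimes\nu_R^l)\nu_R^r=(\nu_R^r\otimes 1)\nu_R^l$; 4. $(\nu_L^l\otimes 1)(1\otimes\nu_R^l)=L_2\nu_L^l$, $\ (1\otimes\nu_L^r)(\nu_R^r\otimes 1)=L_2\nu_L^r$, $\ (1\otimes\nu_L^l)(\nu_R^l\otimes 1)=\nu_R^l r_2$, $\ (\nu_L^r\otimes 1)(1\otimes\nu_R^r)=\nu_R^r r_2$; 5. $(1\otimes\nu_L^l)(L_2\otimes 1)=L_2\nu_L^l$, $\ (\nu_L^r\otimes 1)(1\otimes L_2)=L_2\nu_L^r$, $\ (r_2\otimes 1)(1\otimes\nu_R^l)=\nu_R^l r_2$, $\ (1\otimes r_2)(\nu_R^r\otimes 1)=\nu_R^r r_2$. They compose component-wise, e.g. with $\nu^r_{R'R}=\nu^r_{R'}\circ R'\nu^r_R$. A *linearly distributive natural transformation* $(R,L)\to(R',L')$ is a pair of a monoidal natural transformation $\rho:R\to R'$ and a comonoidal natural transformation $\lambda:L'\to L$ with $\lambda\nu_{L'}^l(1\otimes\rho)=\nu_L^l(\lambda\otimes1)$,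 $\lambda\nu_{L'}^r(\rho\otimes1)=\nu_L^r(1\otimes\lambda)$, $(1\otimes\lambda)\nu_{R'}^l\rho=(\rho\otimes1)\nu_R^l$, $(\lambda\otimes1)\nu_{R'}^r\rho=(1\otimes\rho)\nu_R^r$. Monoidal categories, linearly distributive functors and linearly distributive natural transformations form a 2-category $\mathbf{MonLinDist}$. A strong monoidal functor $U$ gives the linearly distributive functor $(U,U)$ with $\nu_R^r=\nu_R^l=u_2^{-1}$ and $\nu_L^r=\nu_L^l=u_2$. A *Hopf monad* on $\mathcal C$ is a monad $(T,\mu,\eta)$ with $T$ a comonoidal functor and $\mu,\eta$ comonoidal, such that both fusion operators $(1\otimes\mu_Y)T_2:T(X\otimes TY)\to TX\otimes TY$ and $(\mu_X\otimes1)T_2:T(TX\otimes Y)\to TX\otimes TY$ are invertible. Dually, a *Hopf comonad* is a monoidal comonad $(G,\delta,\varepsilon)$ such that $G_2(1\otimes\delta_Y):GX\otimes GY\to G(X\otimes GY)$ and $G_2(\delta_X\otimes1):GX\otimes GY\to G(GX\otimes Y)$ are invertible. If a comonoidal monad $T$ has a right adjoint functor $G$, then $G$ carries the comonad structure $(\delta,\varepsilon)$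 whose structure maps are the mates of $\mu,\eta$, and the monoidal structure that is the mate of the comonoidal structure of $T$; $T$ is a *biHopf monad* if $T$ is a Hopf monad and $G$ is a Hopf comonad. For a comonoidal monad $T$, the category $\mathcal C^T$ of $T$-algebras is monoidal with strict monoidal forgetful functor $U^T:\mathcal C^T\to\mathcal C$. Its left adjoint is the free functor $L^T$, with unit $\eta^l$ and counit $\varepsilon^l$. If $T$ has a right adjoint $G$, then $U^T$ has the right adjoint $R^T$, which sends $X$ to $GX$ with the $T$-action corresponding under $T\dashv G$ to the cofree coaction $\delta_X:GX\to GGX$; let $\eta^r$ and $\varepsilon^r$ be its unit and counit. As left, respectively right, adjoint of the strong monoidal functor $U^T$, $L^T$ is comonoidal and $R^T$ is monoidal. **Corollary.** Let $T$ be a biHopf monad on a monoidal category $\mathcal C$, with right adjoint $G$. Then: * with suitable strengths and costrengths, $(R^T,L^T):\mathcal C\to\mathcal C^T$ is a linearly distributive functor and there is an adjunction $(U^T,U^T)\dashv(R^T,L^T)$ in $\mathbf{MonLinDist}$ with unit $(\eta^r,\varepsilon^l)$ and counit $(\varepsilon^r,\eta^l)$; * with suitable strengths and costrengths, the pair $(G,T):\mathcal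 C\to\mathcal C$ is a linearly distributive functor and a comonad in $\mathbf{MonLinDist}$, with counit $(\varepsilon,\eta)$ and comultiplication $(\delta,\mu)$; * this comonad is induced by that adjunction: $(G,T)$ coincides with $(U^T,U^T)\circ(R^T,L^T)$, as a comonad in $\mathbf{MonLinDist}$, through the identity transformations of $U^TR^T=G$ and $U^TL^T=T$. -/

import Mathlib

open CategoryTheory

universe w v u v₁ u₁ v₂ u₂ v₃ u₃

section InducedComonad

open Bicategory

variable {B : Type u} [Bicategory.{w, v} B] {a b : B} {f : a ⟶ b} {g : b ⟶ a}

/-- The comultiplication `g ≫ f ⟶ (g ≫ f) ≫ (g ≫ f)` induced by the unit of an adjunction. -/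
def inducedComul (A : f ⊣ g) : g ≫ f ⟶ (g ≫ f) ≫ (g ≫ f) :=
  g ◁ (λ_ f).inv ≫ g ◁ A.unit ▷ f ≫ g ◁ (α_ f g f).hom ≫ (α_ g f (g ≫ f)).inv

theorem inducedComul_counit_left (A : f ⊣ g) :
    inducedComul A ≫ A.counit ▷ (g ≫ f) = (λ_ (g ≫ f)).inv :=
  calc
    _ = 𝟙 _ ⊗≫ rightZigzag A.unit A.counit ▷ f ⊗≫ 𝟙 _ := by
      dsimp only [inducedComul, rightZigzag]; bicategory
    _ = _ := by rw [A.right_triangle]; bicategory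

theorem inducedComul_counit_right (A : f ⊣ g) :
    inducedComul A ≫ (g ≫ f) ◁ A.counit = (ρ_ (g ≫ f)).inv :=
  calc
    _ = 𝟙 _ ⊗≫ g ◁ leftZigzag A.unit A.counit ⊗≫ 𝟙 _ := by
      dsimp only [inducedComul, leftZigzag]; bicategory
    _ = _ := by rw [A.left_triangle]; bicategory

theorem inducedComul_coassoc (A : f ⊣ g) :
    inducedComul A ≫ (g ≫ f) ◁ inducedComul A =
      inducedComul A ≫ inducedComul A ▷ (g ≫ f) ≫ (α_ (g ≫ f) (g ≫ f) (g ≫ f)).hom :=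
  calc
    _ = 𝟙 _ ⊗≫ g ◁ (A.unit ▷ 𝟙 a ≫ (f ≫ g) ◁ A.unit) ▷ f ⊗≫ 𝟙 _ := by
      dsimp only [inducedComul]; bicategory
    _ = 𝟙 _ ⊗≫ g ◁ (𝟙 a ◁ A.unit ≫ A.unit ▷ (f ≫ g)) ▷ f ⊗≫ 𝟙 _ := by
      rw [whisker_exchange]
    _ = _ := by dsimp only [inducedComul]; bicategory

/-- The comonad on `g ≫ f` induced by an adjunction `f ⊣ g` in a bicategory. -/
abbrev inducedComonad (A : f ⊣ g) : Bicategory.Comonad (g ≫ f) where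
  counit := A.counit
  comul := inducedComul A
  counit_comul := inducedComul_counit_left A
  comul_counit := inducedComul_counit_right A
  comul_assoc := inducedComul_coassoc A

/-- A `2`-cell `θ : t ⟶ t'` is a morphism of comonads if it is compatible with the counits and
the comultiplications. -/
structure IsComonadHom {t t' : a ⟶ a} (K : Bicategory.Comonad t) (K' : Bicategory.Comonad t')
    (θ : t ⟶ t') : Prop where
  counit : θ ≫ K'.counit = K.counit
  comul : θ ≫ K'.comul = K.comul ≫ θ ▷ t ≫ t' ◁ θ

end InducedComonad

open MonoidalCategory Functor.LaxMonoidal Functor.OplaxMonoidal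


section Transformations

variable {C : Type u₁} [Category.{v₁} C] [MonoidalCategory C]
  {D : Type u₂} [Category.{v₂} D] [MonoidalCategory D]
  {E : Type u₃} [Category.{v₃} E] [MonoidalCategory E]

/-- A natural transformation between comonoidal (oplax monoidal) functors is comonoidal if it is
compatible with the structure morphisms `δ : F (X ⊗ Y) ⟶ F X ⊗ F Y` and `η : F 𝟙 ⟶ 𝟙`. -/
class IsComonoidalTrans {F₁ F₂ : C ⥤ D} [F₁.OplaxMonoidal] [F₂.OplaxMonoidal]
    (τ : F₁ ⟶ F₂) : Prop where
  counit : τ.app (𝟙_ C) ≫ η F₂ = η F₁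
  cotensor (X Y : C) : τ.app (X ⊗ Y) ≫ δ F₂ X Y = δ F₁ X Y ≫ (τ.app X ⊗ₘ τ.app Y)

/-- The strengths and costrengths making a pair `(R, L)`, with `R` monoidal and `L` comonoidal,
a linearly distributive functor between monoidal categories. Associativity and unit constraints
are written out. -/
structure LinDistStructure (R L : C ⥤ D) [R.LaxMonoidal] [L.OplaxMonoidal] where
  νRr (X Y : C) : R.obj (X ⊗ Y) ⟶ L.obj X ⊗ R.obj Y
  νRl (X Y : C) : R.obj (X ⊗ Y) ⟶ R.obj X ⊗ L.obj Y
  νLr (X Y : C) : R.obj X ⊗ L.obj Y ⟶ L.obj (X ⊗ Y)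
  νLl (X Y : C) : L.obj X ⊗ R.obj Y ⟶ L.obj (X ⊗ Y)
  -- naturality
  νRr_natural {X X' Y Y' : C} (f : X ⟶ X') (g : Y ⟶ Y') :
    R.map (f ⊗ₘ g) ≫ νRr X' Y' = νRr X Y ≫ (L.map f ⊗ₘ R.map g)
  νRl_natural {X X' Y Y' : C} (f : X ⟶ X') (g : Y ⟶ Y') :
    R.map (f ⊗ₘ g) ≫ νRl X' Y' = νRl X Y ≫ (R.map f ⊗ₘ L.map g)
  νLr_natural {X X' Y Y' : C} (f : X ⟶ X') (g : Y ⟶ Y') :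
    (R.map f ⊗ₘ L.map g) ≫ νLr X' Y' = νLr X Y ≫ L.map (f ⊗ₘ g)
  νLl_natural {X X' Y Y' : C} (f : X ⟶ X') (g : Y ⟶ Y') :
    (L.map f ⊗ₘ R.map g) ≫ νLl X' Y' = νLl X Y ≫ L.map (f ⊗ₘ g)
  -- unit laws
  unit_Ll (X : C) : L.obj X ◁ ε R ≫ νLl X (𝟙_ C) ≫ L.map (ρ_ X).hom = (ρ_ (L.obj X)).hom
  unit_Lr (X : C) : ε R ▷ L.obj X ≫ νLr (𝟙_ C) X ≫ L.map (λ_ X).hom = (λ_ (L.obj X)).hom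
  unit_Rl (X : C) : R.map (ρ_ X).inv ≫ νRl X (𝟙_ C) ≫ R.obj X ◁ η L = (ρ_ (R.obj X)).inv
  unit_Rr (X : C) : R.map (λ_ X).inv ≫ νRr (𝟙_ C) X ≫ η L ▷ R.obj X = (λ_ (R.obj X)).inv
  -- (co)associativity of the (co)actions
  act_Ll (X Y Z : C) :
    νLl X Y ▷ R.obj Z ≫ νLl (X ⊗ Y) Z ≫ L.map (α_ X Y Z).hom =
      (α_ (L.obj X) (R.obj Y) (R.obj Z)).hom ≫ L.obj X ◁ μ R Y Z ≫ νLl X (Y ⊗ Z)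
  act_Lr (X Y Z : C) :
    μ R X Y ▷ L.obj Z ≫ νLr (X ⊗ Y) Z ≫ L.map (α_ X Y Z).hom =
      (α_ (R.obj X) (R.obj Y) (L.obj Z)).hom ≫ R.obj X ◁ νLr Y Z ≫ νLr X (Y ⊗ Z)
  act_Rl (X Y Z : C) :
    νRl (X ⊗ Y) Z ≫ νRl X Y ▷ L.obj Z ≫ (α_ (R.obj X) (L.obj Y) (L.obj Z)).hom =
      R.map (α_ X Y Z).hom ≫ νRl X (Y ⊗ Z) ≫ R.obj X ◁ δ L Y Z
  act_Rr (X Y Z : C) :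
    νRr (X ⊗ Y) Z ≫ δ L X Y ▷ R.obj Z ≫ (α_ (L.obj X) (L.obj Y) (R.obj Z)).hom =
      R.map (α_ X Y Z).hom ≫ νRr X (Y ⊗ Z) ≫ L.obj X ◁ νRr Y Z
  -- the left and right (co)actions commute
  bi_L (X Y Z : C) :
    νLr X Y ▷ R.obj Z ≫ νLl (X ⊗ Y) Z ≫ L.map (α_ X Y Z).hom =
      (α_ (R.obj X) (L.obj Y) (R.obj Z)).hom ≫ R.obj X ◁ νLl Y Z ≫ νLr X (Y ⊗ Z)
  bi_R (X Y Z : C) :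
    νRl (X ⊗ Y) Z ≫ νRr X Y ▷ L.obj Z ≫ (α_ (L.obj X) (R.obj Y) (L.obj Z)).hom =
      R.map (α_ X Y Z).hom ≫ νRr X (Y ⊗ Z) ≫ L.obj X ◁ νRl Y Z
  -- compatibility of strengths with costrengths
  mix_Ll (X Y Z : C) :
    L.obj X ◁ νRl Y Z ≫ (α_ (L.obj X) (R.obj Y) (L.obj Z)).inv ≫ νLl X Y ▷ L.obj Z =
      νLl X (Y ⊗ Z) ≫ L.map (α_ X Y Z).inv ≫ δ L (X ⊗ Y) Z
  mix_Lr (X Y Z : C) :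
    νRr X Y ▷ L.obj Z ≫ (α_ (L.obj X) (R.obj Y) (L.obj Z)).hom ≫ L.obj X ◁ νLr Y Z =
      νLr (X ⊗ Y) Z ≫ L.map (α_ X Y Z).hom ≫ δ L X (Y ⊗ Z)
  mix_Rl (X Y Z : C) :
    νRl X Y ▷ R.obj Z ≫ (α_ (R.obj X) (L.obj Y) (R.obj Z)).hom ≫ R.obj X ◁ νLl Y Z =
      μ R (X ⊗ Y) Z ≫ R.map (α_ X Y Z).hom ≫ νRl X (Y ⊗ Z)
  mix_Rr (X Y Z : C) :
    R.obj X ◁ νRr Y Z ≫ (α_ (R.obj X) (L.obj Y) (R.obj Z)).inv ≫ νLr X Y ▷ R.obj Z =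
      μ R X (Y ⊗ Z) ≫ R.map (α_ X Y Z).inv ≫ νRr (X ⊗ Y) Z
  -- compatibility of the (co)strengths with the (co)monoidal structures
  str_Ll (X Y Z : C) :
    δ L X Y ▷ R.obj Z ≫ (α_ (L.obj X) (L.obj Y) (R.obj Z)).hom ≫ L.obj X ◁ νLl Y Z =
      νLl (X ⊗ Y) Z ≫ L.map (α_ X Y Z).hom ≫ δ L X (Y ⊗ Z)
  str_Lr (X Y Z : C) :
    R.obj X ◁ δ L Y Z ≫ (α_ (R.obj X) (L.obj Y) (L.obj Z)).inv ≫ νLr X Y ▷ L.obj Z =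
      νLr X (Y ⊗ Z) ≫ L.map (α_ X Y Z).inv ≫ δ L (X ⊗ Y) Z
  str_Rl (X Y Z : C) :
    R.obj X ◁ νRl Y Z ≫ (α_ (R.obj X) (R.obj Y) (L.obj Z)).inv ≫ μ R X Y ▷ L.obj Z =
      μ R X (Y ⊗ Z) ≫ R.map (α_ X Y Z).inv ≫ νRl (X ⊗ Y) Z
  str_Rr (X Y Z : C) :
    νRr X Y ▷ R.obj Z ≫ (α_ (L.obj X) (R.obj Y) (R.obj Z)).hom ≫ L.obj X ◁ μ R Y Z =
      μ R (X ⊗ Y) Z ≫ R.map (α_ X Y Z).hom ≫ νRr X (Y ⊗ Z)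

namespace LinDistStructure

section Naturality

variable {R L : C ⥤ D} [R.LaxMonoidal] [L.OplaxMonoidal] (s : LinDistStructure R L)

theorem νRr_left {X X' : C} (f : X ⟶ X') (Y : C) :
    R.map (f ▷ Y) ≫ s.νRr X' Y = s.νRr X Y ≫ L.map f ▷ R.obj Y := by
  simpa using s.νRr_natural f (𝟙 Y)

theorem νRr_right (X : C) {Y Y' : C} (g : Y ⟶ Y') :
    R.map (X ◁ g) ≫ s.νRr X Y' = s.νRr X Y ≫ L.obj X ◁ R.map g := by
  simpa using s.νRr_natural (𝟙 X) g

theorem νRl_left {X X' : C} (f : X ⟶ X') (Y : C) :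
    R.map (f ▷ Y) ≫ s.νRl X' Y = s.νRl X Y ≫ R.map f ▷ L.obj Y := by
  simpa using s.νRl_natural f (𝟙 Y)

theorem νRl_right (X : C) {Y Y' : C} (g : Y ⟶ Y') :
    R.map (X ◁ g) ≫ s.νRl X Y' = s.νRl X Y ≫ R.obj X ◁ L.map g := by
  simpa using s.νRl_natural (𝟙 X) g

theorem νLr_left {X X' : C} (f : X ⟶ X') (Y : C) :
    R.map f ▷ L.obj Y ≫ s.νLr X' Y = s.νLr X Y ≫ L.map (f ▷ Y) := by
  simpa using s.νLr_natural f (𝟙 Y)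

theorem νLr_right (X : C) {Y Y' : C} (g : Y ⟶ Y') :
    R.obj X ◁ L.map g ≫ s.νLr X Y' = s.νLr X Y ≫ L.map (X ◁ g) := by
  simpa using s.νLr_natural (𝟙 X) g

theorem νLl_left {X X' : C} (f : X ⟶ X') (Y : C) :
    L.map f ▷ R.obj Y ≫ s.νLl X' Y = s.νLl X Y ≫ L.map (f ▷ Y) := by
  simpa using s.νLl_natural f (𝟙 Y)

theorem νLl_right (X : C) {Y Y' : C} (g : Y ⟶ Y') :
    L.obj X ◁ R.map g ≫ s.νLl X Y' = s.νLl X Y ≫ L.map (X ◁ g) := by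
  simpa using s.νLl_natural (𝟙 X) g

end Naturality

/-- A strong monoidal functor `U` gives the linearly distributive functor `(U, U)`, with
strengths and costrengths given by the monoidal structure of `U` and its inverse. -/
def ofMonoidal (U : C ⥤ D) [U.Monoidal] : LinDistStructure U U where
  νRr X Y := δ U X Y
  νRl X Y := δ U X Y
  νLr X Y := μ U X Y
  νLl X Y := μ U X Y
  νRr_natural := by simp
  νRl_natural := by simp
  νLr_natural := by simp
  νLl_natural := by simp
  unit_Ll := by simp
  unit_Lr := by simp
  unit_Rl := by simp
  unit_Rr := by simp
  act_Ll := by simp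
  act_Lr := by simp
  act_Rl := by simp
  act_Rr := by simp
  bi_L := by simp
  bi_R := by simp
  mix_Ll X Y Z := by simp only [Functor.Monoidal.map_associator_inv, Category.assoc, Functor.Monoidal.μ_δ_assoc, Functor.Monoidal.μ_δ, Category.comp_id]
  mix_Lr X Y Z := by simp only [Functor.Monoidal.map_associator, Category.assoc, Functor.Monoidal.μ_δ_assoc, Functor.Monoidal.μ_δ, Category.comp_id]
  mix_Rl X Y Z := by simp only [Functor.Monoidal.map_associator, Category.assoc, Functor.Monoidal.μ_δ_assoc, Functor.Monoidal.μ_δ, Category.comp_id]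
  mix_Rr X Y Z := by simp only [Functor.Monoidal.map_associator_inv, Category.assoc, Functor.Monoidal.μ_δ_assoc, Functor.Monoidal.μ_δ, Category.comp_id]
  str_Ll X Y Z := by simp only [Functor.Monoidal.map_associator, Category.assoc, Functor.Monoidal.μ_δ_assoc, Functor.Monoidal.μ_δ, Category.comp_id]
  str_Lr X Y Z := by simp only [Functor.Monoidal.map_associator_inv, Category.assoc, Functor.Monoidal.μ_δ_assoc, Functor.Monoidal.μ_δ, Category.comp_id]
  str_Rl X Y Z := by simp only [Functor.Monoidal.map_associator_inv, Category.assoc, Functor.Monoidal.μ_δ_assoc, Functor.Monoidal.μ_δ, Category.comp_id]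
  str_Rr X Y Z := by simp only [Functor.Monoidal.map_associator, Category.assoc, Functor.Monoidal.μ_δ_assoc, Functor.Monoidal.μ_δ, Category.comp_id]

end LinDistStructure

end Transformations
section Composition

variable {C : Type u₁} [Category.{v₁} C] [MonoidalCategory C]
  {D : Type u₂} [Category.{v₂} D] [MonoidalCategory D]
  {E : Type u₃} [Category.{v₃} E] [MonoidalCategory E]

open LinDistStructure in
/-- Component-wise composition of linearly distributive functors. -/
def LinDistStructure.comp {R L : C ⥤ D} [R.LaxMonoidal] [L.OplaxMonoidal]
    {R' L' : D ⥤ E} [R'.LaxMonoidal] [L'.OplaxMonoidal]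
    (s : LinDistStructure R L) (t : LinDistStructure R' L') :
    LinDistStructure (R ⋙ R') (L ⋙ L') where
  νRr X Y := R'.map (s.νRr X Y) ≫ t.νRr (L.obj X) (R.obj Y)
  νRl X Y := R'.map (s.νRl X Y) ≫ t.νRl (R.obj X) (L.obj Y)
  νLr X Y := t.νLr (R.obj X) (L.obj Y) ≫ L'.map (s.νLr X Y)
  νLl X Y := t.νLl (L.obj X) (R.obj Y) ≫ L'.map (s.νLl X Y)
  νRr_natural f g := by
    simp only [Functor.comp_map, Functor.comp_obj, Category.assoc]
    rw [← t.νRr_natural, ← Functor.map_comp_assoc, s.νRr_natural, Functor.map_comp_assoc]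
  νRl_natural f g := by
    simp only [Functor.comp_map, Functor.comp_obj, Category.assoc]
    rw [← t.νRl_natural, ← Functor.map_comp_assoc, s.νRl_natural, Functor.map_comp_assoc]
  νLr_natural f g := by
    simp only [Functor.comp_map, Functor.comp_obj, Category.assoc]
    rw [← Functor.map_comp, ← s.νLr_natural, Functor.map_comp, ← Category.assoc, t.νLr_natural,
      Category.assoc]
  νLl_natural f g := by
    simp only [Functor.comp_map, Functor.comp_obj, Category.assoc]
    rw [← Functor.map_comp, ← s.νLl_natural, Functor.map_comp, ← Category.assoc, t.νLl_natural,
      Category.assoc]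
  unit_Ll X := by
    have h := t.νLl_right (L.obj X) (ε R)
    have h1 := congrArg L'.map (s.unit_Ll X)
    have h2 := t.unit_Ll (L.obj X)
    simp only [Functor.map_comp] at h1
    simp only [comp_ε, MonoidalCategory.whiskerLeft_comp, Functor.comp_map, Functor.comp_obj,
      Category.assoc, reassoc_of% h, h1, h2]
  unit_Lr X := by
    have h := t.νLr_left (ε R) (L.obj X)
    have h1 := congrArg L'.map (s.unit_Lr X)
    have h2 := t.unit_Lr (L.obj X)
    simp only [Functor.map_comp] at h1
    simp only [comp_ε, MonoidalCategory.comp_whiskerRight, Functor.comp_map, Functor.comp_obj,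
      Category.assoc, reassoc_of% h, h1, h2]
  unit_Rl X := by
    have h := t.νRl_right (R.obj X) (η L)
    have h1 := congrArg R'.map (s.unit_Rl X)
    have h2 := t.unit_Rl (R.obj X)
    simp only [Functor.map_comp] at h1
    simp only [comp_η, MonoidalCategory.whiskerLeft_comp, Functor.comp_map, Functor.comp_obj,
      Category.assoc, ← reassoc_of% h, reassoc_of% h1, h2]
  unit_Rr X := by
    have h := t.νRr_left (η L) (R.obj X)
    have h1 := congrArg R'.map (s.unit_Rr X)
    have h2 := t.unit_Rr (R.obj X)
    simp only [Functor.map_comp] at h1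
    simp only [comp_η, MonoidalCategory.comp_whiskerRight, Functor.comp_map, Functor.comp_obj,
      Category.assoc, ← reassoc_of% h, reassoc_of% h1, h2]
  act_Ll X Y Z := by
    have h1 := congrArg L'.map (s.act_Ll X Y Z)
    have h2 := t.act_Ll (L.obj X) (R.obj Y) (R.obj Z)
    simp only [Functor.map_comp] at h1
    simp only [comp_μ, MonoidalCategory.comp_whiskerRight, MonoidalCategory.whiskerLeft_comp,
      Functor.comp_map, Functor.comp_obj, Category.assoc,
      reassoc_of% (t.νLl_left), reassoc_of% (t.νLl_right), h1, reassoc_of% h2]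
  act_Lr X Y Z := by
    have h1 := congrArg L'.map (s.act_Lr X Y Z)
    have h2 := t.act_Lr (R.obj X) (R.obj Y) (L.obj Z)
    simp only [Functor.map_comp] at h1
    simp only [comp_μ, MonoidalCategory.comp_whiskerRight, MonoidalCategory.whiskerLeft_comp,
      Functor.comp_map, Functor.comp_obj, Category.assoc,
      reassoc_of% (t.νLr_left), reassoc_of% (t.νLr_right), h1, reassoc_of% h2]
  act_Rl X Y Z := by
    have h1 := congrArg R'.map (s.act_Rl X Y Z)
    have h2 := t.act_Rl (R.obj X) (L.obj Y) (L.obj Z)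
    simp only [Functor.map_comp] at h1
    simp only [comp_δ, MonoidalCategory.comp_whiskerRight, MonoidalCategory.whiskerLeft_comp,
      Functor.comp_map, Functor.comp_obj, Category.assoc,
      ← reassoc_of% (t.νRl_left), ← reassoc_of% (t.νRl_right), h2, reassoc_of% h1]
  act_Rr X Y Z := by
    have h1 := congrArg R'.map (s.act_Rr X Y Z)
    have h2 := t.act_Rr (L.obj X) (L.obj Y) (R.obj Z)
    simp only [Functor.map_comp] at h1
    simp only [comp_δ, MonoidalCategory.comp_whiskerRight, MonoidalCategory.whiskerLeft_comp,
      Functor.comp_map, Functor.comp_obj, Category.assoc,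
      ← reassoc_of% (t.νRr_left), ← reassoc_of% (t.νRr_right), h2, reassoc_of% h1]
  bi_L X Y Z := by
    have h1 := congrArg L'.map (s.bi_L X Y Z)
    have h2 := t.bi_L (R.obj X) (L.obj Y) (R.obj Z)
    simp only [Functor.map_comp] at h1
    simp only [MonoidalCategory.comp_whiskerRight, MonoidalCategory.whiskerLeft_comp,
      Functor.comp_map, Functor.comp_obj, Category.assoc,
      reassoc_of% (t.νLl_left), reassoc_of% (t.νLr_right), h1, reassoc_of% h2]
  bi_R X Y Z := by
    have h1 := congrArg R'.map (s.bi_R X Y Z)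
    have h2 := t.bi_R (L.obj X) (R.obj Y) (L.obj Z)
    simp only [Functor.map_comp] at h1
    simp only [MonoidalCategory.comp_whiskerRight, MonoidalCategory.whiskerLeft_comp,
      Functor.comp_map, Functor.comp_obj, Category.assoc,
      ← reassoc_of% (t.νRl_left), ← reassoc_of% (t.νRr_right), h2, reassoc_of% h1]
  mix_Ll X Y Z := by
    have h1 := congrArg L'.map (s.mix_Ll X Y Z)
    have h2 := t.mix_Ll (L.obj X) (R.obj Y) (L.obj Z)
    simp only [Functor.map_comp] at h1
    simp only [comp_δ, MonoidalCategory.comp_whiskerRight, MonoidalCategory.whiskerLeft_comp,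
      Functor.comp_map, Functor.comp_obj, Category.assoc, reassoc_of% h2, reassoc_of% (t.νLl_right),
      ← δ_natural_left, ← reassoc_of% h1]
  mix_Lr X Y Z := by
    have h1 := congrArg L'.map (s.mix_Lr X Y Z)
    have h2 := t.mix_Lr (L.obj X) (R.obj Y) (L.obj Z)
    simp only [Functor.map_comp] at h1
    simp only [comp_δ, MonoidalCategory.comp_whiskerRight, MonoidalCategory.whiskerLeft_comp,
      Functor.comp_map, Functor.comp_obj, Category.assoc, reassoc_of% h2, reassoc_of% (t.νLr_left),
      ← δ_natural_right, ← reassoc_of% h1]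
  mix_Rl X Y Z := by
    have h1 := congrArg R'.map (s.mix_Rl X Y Z)
    have h2 := t.mix_Rl (R.obj X) (L.obj Y) (R.obj Z)
    simp only [Functor.map_comp] at h1
    simp only [comp_μ, MonoidalCategory.comp_whiskerRight, MonoidalCategory.whiskerLeft_comp,
      Functor.comp_map, Functor.comp_obj, Category.assoc, reassoc_of% h2, ← t.νRl_right,
      μ_natural_left_assoc, ← reassoc_of% h1]
  mix_Rr X Y Z := by
    have h1 := congrArg R'.map (s.mix_Rr X Y Z)
    have h2 := t.mix_Rr (R.obj X) (L.obj Y) (R.obj Z)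
    simp only [Functor.map_comp] at h1
    simp only [comp_μ, MonoidalCategory.comp_whiskerRight, MonoidalCategory.whiskerLeft_comp,
      Functor.comp_map, Functor.comp_obj, Category.assoc, reassoc_of% h2, ← t.νRr_left,
      μ_natural_right_assoc, ← reassoc_of% h1]
  str_Ll X Y Z := by
    have h1 := congrArg L'.map (s.str_Ll X Y Z)
    have h2 := t.str_Ll (L.obj X) (L.obj Y) (R.obj Z)
    simp only [Functor.map_comp] at h1
    simp only [comp_δ, MonoidalCategory.comp_whiskerRight, MonoidalCategory.whiskerLeft_comp,
      Functor.comp_map, Functor.comp_obj, Category.assoc, reassoc_of% h2, reassoc_of% (t.νLl_left),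
      ← δ_natural_right, ← reassoc_of% h1]
  str_Lr X Y Z := by
    have h1 := congrArg L'.map (s.str_Lr X Y Z)
    have h2 := t.str_Lr (R.obj X) (L.obj Y) (L.obj Z)
    simp only [Functor.map_comp] at h1
    simp only [comp_δ, MonoidalCategory.comp_whiskerRight, MonoidalCategory.whiskerLeft_comp,
      Functor.comp_map, Functor.comp_obj, Category.assoc, reassoc_of% h2, reassoc_of% (t.νLr_right),
      ← δ_natural_left, ← reassoc_of% h1]
  str_Rl X Y Z := by
    have h1 := congrArg R'.map (s.str_Rl X Y Z)
    have h2 := t.str_Rl (R.obj X) (R.obj Y) (L.obj Z)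
    simp only [Functor.map_comp] at h1
    simp only [comp_μ, MonoidalCategory.comp_whiskerRight, MonoidalCategory.whiskerLeft_comp,
      Functor.comp_map, Functor.comp_obj, Category.assoc, reassoc_of% h2, ← t.νRl_left,
      μ_natural_right_assoc, ← reassoc_of% h1]
  str_Rr X Y Z := by
    have h1 := congrArg R'.map (s.str_Rr X Y Z)
    have h2 := t.str_Rr (L.obj X) (R.obj Y) (R.obj Z)
    simp only [Functor.map_comp] at h1
    simp only [comp_μ, MonoidalCategory.comp_whiskerRight, MonoidalCategory.whiskerLeft_comp,
      Functor.comp_map, Functor.comp_obj, Category.assoc, reassoc_of% h2, ← t.νRr_right,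
      μ_natural_left_assoc, ← reassoc_of% h1]

theorem IsComonoidalTrans.whiskerLeft (F : C ⥤ D) [F.OplaxMonoidal] {G H : D ⥤ E}
    [G.OplaxMonoidal] [H.OplaxMonoidal] (τ : G ⟶ H) [h : IsComonoidalTrans τ] :
    IsComonoidalTrans (Functor.whiskerLeft F τ) where
  counit := by
    simp only [Functor.whiskerLeft_app, comp_η, ← NatTrans.naturality_assoc, h.counit]
  cotensor X Y := by
    simp only [Functor.whiskerLeft_app, comp_δ, ← NatTrans.naturality_assoc, h.cotensor,
      Category.assoc, Functor.comp_obj]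

theorem IsComonoidalTrans.whiskerRight {F G : C ⥤ D} [F.OplaxMonoidal] [G.OplaxMonoidal]
    (τ : F ⟶ G) [h : IsComonoidalTrans τ] (H : D ⥤ E) [H.OplaxMonoidal] :
    IsComonoidalTrans (Functor.whiskerRight τ H) where
  counit := by
    simp only [Functor.whiskerRight_app, comp_η, ← Functor.map_comp_assoc, h.counit]
  cotensor X Y := by
    simp only [Functor.whiskerRight_app, comp_δ, ← Functor.map_comp_assoc, h.cotensor,
      Category.assoc]
    simp only [Functor.map_comp, Category.assoc, Functor.comp_obj, δ_natural]

theorem IsComonoidalTrans.associator_hom {B : Type u} [Category.{v} B] [MonoidalCategory B]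
    (F : B ⥤ C) (G : C ⥤ D) (H : D ⥤ E) [F.OplaxMonoidal] [G.OplaxMonoidal] [H.OplaxMonoidal] :
    IsComonoidalTrans (Functor.associator F G H).hom :=
  ⟨by simp, by simp⟩

theorem IsComonoidalTrans.associator_inv {B : Type u} [Category.{v} B] [MonoidalCategory B]
    (F : B ⥤ C) (G : C ⥤ D) (H : D ⥤ E) [F.OplaxMonoidal] [G.OplaxMonoidal] [H.OplaxMonoidal] :
    IsComonoidalTrans (Functor.associator F G H).inv :=
  ⟨by simp, by simp⟩

theorem IsComonoidalTrans.leftUnitor_hom (F : C ⥤ D) [F.OplaxMonoidal] :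
    IsComonoidalTrans F.leftUnitor.hom :=
  ⟨by simp, by simp⟩

theorem IsComonoidalTrans.leftUnitor_inv (F : C ⥤ D) [F.OplaxMonoidal] :
    IsComonoidalTrans F.leftUnitor.inv :=
  ⟨by simp, by simp⟩

theorem IsComonoidalTrans.rightUnitor_hom (F : C ⥤ D) [F.OplaxMonoidal] :
    IsComonoidalTrans F.rightUnitor.hom :=
  ⟨by simp, by simp⟩

theorem IsComonoidalTrans.rightUnitor_inv (F : C ⥤ D) [F.OplaxMonoidal] :
    IsComonoidalTrans F.rightUnitor.inv :=
  ⟨by simp, by simp⟩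

end Composition

section TwoCategory

/-- A linearly distributive functor between monoidal categories. -/
structure LinDistFunctor (C : Type u₁) [Category.{v₁} C] [MonoidalCategory C]
    (D : Type u₂) [Category.{v₂} D] [MonoidalCategory D] where
  R : C ⥤ D
  L : C ⥤ D
  [monoidal : R.LaxMonoidal]
  [comonoidal : L.OplaxMonoidal]
  str : LinDistStructure R L

attribute [instance] LinDistFunctor.monoidal LinDistFunctor.comonoidal

variable {C : Type u₁} [Category.{v₁} C] [MonoidalCategory C]
  {D : Type u₂} [Category.{v₂} D] [MonoidalCategory D]
  {E : Type u₃} [Category.{v₃} E] [MonoidalCategory E]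

/-- A linearly distributive natural transformation `(R, L) ⟶ (R', L')`: a monoidal
`ρ : R ⟶ R'` and a comonoidal `lam : L' ⟶ L` compatible with the (co)strengths. -/
structure LinDistTrans (F G : LinDistFunctor C D) where
  ρ : F.R ⟶ G.R
  lam : G.L ⟶ F.L
  monoidal : NatTrans.IsMonoidal ρ
  comonoidal : IsComonoidalTrans lam
  comp_Ll (X Y : C) :
    G.L.obj X ◁ ρ.app Y ≫ G.str.νLl X Y ≫ lam.app (X ⊗ Y) =
      lam.app X ▷ F.R.obj Y ≫ F.str.νLl X Y
  comp_Lr (X Y : C) :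
    ρ.app X ▷ G.L.obj Y ≫ G.str.νLr X Y ≫ lam.app (X ⊗ Y) =
      F.R.obj X ◁ lam.app Y ≫ F.str.νLr X Y
  comp_Rl (X Y : C) :
    ρ.app (X ⊗ Y) ≫ G.str.νRl X Y ≫ G.R.obj X ◁ lam.app Y =
      F.str.νRl X Y ≫ ρ.app X ▷ F.L.obj Y
  comp_Rr (X Y : C) :
    ρ.app (X ⊗ Y) ≫ G.str.νRr X Y ≫ lam.app X ▷ G.R.obj Y =
      F.str.νRr X Y ≫ F.L.obj X ◁ ρ.app Y

namespace LinDistTrans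

@[ext]
theorem ext {F G : LinDistFunctor C D} {α β : LinDistTrans F G}
    (h₁ : α.ρ = β.ρ) (h₂ : α.lam = β.lam) : α = β := by
  cases α; cases β; cases h₁; cases h₂; rfl

/-- The identity transformation. -/
def id (F : LinDistFunctor C D) : LinDistTrans F F where
  ρ := 𝟙 F.R
  lam := 𝟙 F.L
  monoidal := inferInstance
  comonoidal := ⟨by simp, by simp⟩
  comp_Ll := by simp
  comp_Lr := by simp
  comp_Rl := by simp
  comp_Rr := by simp

/-- Vertical composition. -/
def comp {F G H : LinDistFunctor C D} (α : LinDistTrans F G) (β : LinDistTrans G H) :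
    LinDistTrans F H where
  ρ := α.ρ ≫ β.ρ
  lam := β.lam ≫ α.lam
  monoidal := by
    have := α.monoidal
    have := β.monoidal
    infer_instance
  comonoidal := by
    have h₁ := α.comonoidal
    have h₂ := β.comonoidal
    refine ⟨?_, fun X Y => ?_⟩
    · simp only [NatTrans.comp_app, Category.assoc, h₁.counit, h₂.counit]
    · simp only [NatTrans.comp_app, Category.assoc, h₁.cotensor, reassoc_of% (h₂.cotensor),
        MonoidalCategory.tensorHom_comp_tensorHom]
  comp_Ll X Y := by
    simp only [NatTrans.comp_app, MonoidalCategory.whiskerLeft_comp,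
      MonoidalCategory.comp_whiskerRight, Category.assoc]
    rw [reassoc_of% (β.comp_Ll X Y), MonoidalCategory.whisker_exchange_assoc, α.comp_Ll]
  comp_Lr X Y := by
    simp only [NatTrans.comp_app, MonoidalCategory.whiskerLeft_comp,
      MonoidalCategory.comp_whiskerRight, Category.assoc]
    rw [reassoc_of% (β.comp_Lr X Y), ← MonoidalCategory.whisker_exchange_assoc, α.comp_Lr]
  comp_Rl X Y := by
    simp only [NatTrans.comp_app, MonoidalCategory.whiskerLeft_comp,
      MonoidalCategory.comp_whiskerRight, Category.assoc]
    rw [reassoc_of% (β.comp_Rl X Y), ← MonoidalCategory.whisker_exchange,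
      reassoc_of% (α.comp_Rl X Y)]
  comp_Rr X Y := by
    simp only [NatTrans.comp_app, MonoidalCategory.whiskerLeft_comp,
      MonoidalCategory.comp_whiskerRight, Category.assoc]
    rw [reassoc_of% (β.comp_Rr X Y), MonoidalCategory.whisker_exchange,
      reassoc_of% (α.comp_Rr X Y)]

end LinDistTrans

instance : Category (LinDistFunctor C D) where
  Hom F G := LinDistTrans F G
  id F := LinDistTrans.id F
  comp α β := LinDistTrans.comp α β
  id_comp _ := LinDistTrans.ext (Category.id_comp _) (Category.comp_id _)
  comp_id _ := LinDistTrans.ext (Category.comp_id _) (Category.id_comp _)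
  assoc _ _ _ := LinDistTrans.ext (Category.assoc _ _ _) (Category.assoc _ _ _).symm

namespace LinDistFunctor

/-- A strong monoidal functor `U`, regarded as the linearly distributive functor `(U, U)`. -/
def ofMonoidal (U : C ⥤ D) [U.Monoidal] : LinDistFunctor C D where
  R := U
  L := U
  str := LinDistStructure.ofMonoidal U

/-- The identity linearly distributive functor. -/
def id (C : Type u₁) [Category.{v₁} C] [MonoidalCategory C] : LinDistFunctor C C :=
  ofMonoidal (𝟭 C)

/-- Component-wise composition, in diagrammatic order. -/
def comp (F : LinDistFunctor C D) (G : LinDistFunctor D E) : LinDistFunctor C E where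
  R := F.R ⋙ G.R
  L := F.L ⋙ G.L
  str := F.str.comp G.str

@[ext]
theorem hom_ext {F G : LinDistFunctor C D} {α β : F ⟶ G}
    (h₁ : LinDistTrans.ρ α = LinDistTrans.ρ β) (h₂ : LinDistTrans.lam α = LinDistTrans.lam β) :
    α = β :=
  LinDistTrans.ext h₁ h₂

theorem comp_ρ {F G H : LinDistFunctor C D} (α : F ⟶ G) (β : G ⟶ H) :
    LinDistTrans.ρ (α ≫ β) = LinDistTrans.ρ α ≫ LinDistTrans.ρ β := rfl

theorem comp_lam {F G H : LinDistFunctor C D} (α : F ⟶ G) (β : G ⟶ H) :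
    LinDistTrans.lam (α ≫ β) = LinDistTrans.lam β ≫ LinDistTrans.lam α := rfl

theorem id_ρ (F : LinDistFunctor C D) : LinDistTrans.ρ (𝟙 F) = 𝟙 F.R := rfl

theorem id_lam (F : LinDistFunctor C D) : LinDistTrans.lam (𝟙 F) = 𝟙 F.L := rfl

/-- Whiskering on the left. -/
def whiskerLeft (F : LinDistFunctor C D) {G H : LinDistFunctor D E} (α : LinDistTrans G H) :
    LinDistTrans (F.comp G) (F.comp H) where
  ρ := Functor.whiskerLeft F.R α.ρ
  lam := Functor.whiskerLeft F.L α.lam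
  monoidal := by
    have := α.monoidal
    exact NatTrans.IsMonoidal.whiskerLeft (F₁ := F.R) α.ρ
  comonoidal := by
    have h := α.comonoidal
    exact IsComonoidalTrans.whiskerLeft F.L α.lam
  comp_Ll X Y := by
    have h := α.comp_Ll (F.L.obj X) (F.R.obj Y)
    simp [comp, LinDistStructure.comp, reassoc_of% h]
  comp_Lr X Y := by
    have h := α.comp_Lr (F.R.obj X) (F.L.obj Y)
    simp [comp, LinDistStructure.comp, reassoc_of% h]
  comp_Rl X Y := by
    have h := α.comp_Rl (F.R.obj X) (F.L.obj Y)
    simp only [comp, LinDistStructure.comp, Functor.comp_obj, Functor.whiskerLeft_app,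
      Category.assoc, ← NatTrans.naturality_assoc, h]
  comp_Rr X Y := by
    have h := α.comp_Rr (F.L.obj X) (F.R.obj Y)
    simp only [comp, LinDistStructure.comp, Functor.comp_obj, Functor.whiskerLeft_app,
      Category.assoc, ← NatTrans.naturality_assoc, h]

/-- Whiskering on the right. -/
def whiskerRight {F G : LinDistFunctor C D} (α : LinDistTrans F G) (H : LinDistFunctor D E) :
    LinDistTrans (F.comp H) (G.comp H) where
  ρ := Functor.whiskerRight α.ρ H.R
  lam := Functor.whiskerRight α.lam H.L
  monoidal := by
    have := α.monoidal
    exact NatTrans.IsMonoidal.whiskerRight (G₁ := H.R) α.ρ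
  comonoidal := by
    have h := α.comonoidal
    exact IsComonoidalTrans.whiskerRight α.lam H.L
  comp_Ll X Y := by
    have h := congrArg H.L.map (α.comp_Ll X Y)
    simp only [Functor.map_comp] at h
    simp [comp, LinDistStructure.comp, reassoc_of% (H.str.νLl_right),
      reassoc_of% (H.str.νLl_left), h]
  comp_Lr X Y := by
    have h := congrArg H.L.map (α.comp_Lr X Y)
    simp only [Functor.map_comp] at h
    simp [comp, LinDistStructure.comp, reassoc_of% (H.str.νLr_right),
      reassoc_of% (H.str.νLr_left), h]
  comp_Rl X Y := by
    have h := congrArg H.R.map (α.comp_Rl X Y)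
    simp only [Functor.map_comp] at h
    simp [comp, LinDistStructure.comp, ← H.str.νRl_right, ← H.str.νRl_left, reassoc_of% h]
  comp_Rr X Y := by
    have h := congrArg H.R.map (α.comp_Rr X Y)
    simp only [Functor.map_comp] at h
    simp [comp, LinDistStructure.comp, ← H.str.νRr_right, ← H.str.νRr_left, reassoc_of% h]

end LinDistFunctor

namespace LinDistFunctor

/-- An isomorphism of linearly distributive functors from a pair of transformations with inverse
components. -/
def isoOfTrans {F G : LinDistFunctor C D} (α : LinDistTrans F G) (β : LinDistTrans G F)
    (h₁ : α.ρ ≫ β.ρ = 𝟙 _) (h₂ : β.ρ ≫ α.ρ = 𝟙 _)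
    (h₃ : β.lam ≫ α.lam = 𝟙 _) (h₄ : α.lam ≫ β.lam = 𝟙 _) : F ≅ G where
  hom := α
  inv := β
  hom_inv_id := LinDistTrans.ext h₁ h₃
  inv_hom_id := LinDistTrans.ext h₂ h₄

/-- The associativity constraint; its components are identities. -/
def associator {B : Type u} [Category.{v} B] [MonoidalCategory B]
    (F : LinDistFunctor B C) (G : LinDistFunctor C D) (H : LinDistFunctor D E) :
    (F.comp G).comp H ≅ F.comp (G.comp H) :=
  isoOfTrans
    { ρ := (Functor.associator F.R G.R H.R).hom
      lam := (Functor.associator F.L G.L H.L).inv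
      monoidal := inferInstanceAs (NatTrans.IsMonoidal (Functor.associator F.R G.R H.R).hom)
      comonoidal := IsComonoidalTrans.associator_inv F.L G.L H.L
      comp_Ll := by simp [comp, LinDistStructure.comp]
      comp_Lr := by simp [comp, LinDistStructure.comp]
      comp_Rl := by simp [comp, LinDistStructure.comp]
      comp_Rr := by simp [comp, LinDistStructure.comp] }
    { ρ := (Functor.associator F.R G.R H.R).inv
      lam := (Functor.associator F.L G.L H.L).hom
      monoidal := inferInstanceAs (NatTrans.IsMonoidal (Functor.associator F.R G.R H.R).inv)
      comonoidal := IsComonoidalTrans.associator_hom F.L G.L H.L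
      comp_Ll := by simp [comp, LinDistStructure.comp]
      comp_Lr := by simp [comp, LinDistStructure.comp]
      comp_Rl := by simp [comp, LinDistStructure.comp]
      comp_Rr := by simp [comp, LinDistStructure.comp] }
    (Functor.associator F.R G.R H.R).hom_inv_id (Functor.associator F.R G.R H.R).inv_hom_id
    (Functor.associator F.L G.L H.L).hom_inv_id (Functor.associator F.L G.L H.L).inv_hom_id

/-- The left unit constraint; its components are identities. -/
def leftUnitor (F : LinDistFunctor C D) : (LinDistFunctor.id C).comp F ≅ F :=
  isoOfTrans
    { ρ := F.R.leftUnitor.hom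
      lam := F.L.leftUnitor.inv
      monoidal := inferInstanceAs (NatTrans.IsMonoidal F.R.leftUnitor.hom)
      comonoidal := IsComonoidalTrans.leftUnitor_inv F.L
      comp_Ll := by simp [comp, id, ofMonoidal, LinDistStructure.comp, LinDistStructure.ofMonoidal]
      comp_Lr := by simp [comp, id, ofMonoidal, LinDistStructure.comp, LinDistStructure.ofMonoidal]
      comp_Rl := by simp [comp, id, ofMonoidal, LinDistStructure.comp, LinDistStructure.ofMonoidal]
      comp_Rr := by simp [comp, id, ofMonoidal, LinDistStructure.comp, LinDistStructure.ofMonoidal] }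
    { ρ := F.R.leftUnitor.inv
      lam := F.L.leftUnitor.hom
      monoidal := inferInstanceAs (NatTrans.IsMonoidal F.R.leftUnitor.inv)
      comonoidal := IsComonoidalTrans.leftUnitor_hom F.L
      comp_Ll := by simp [comp, id, ofMonoidal, LinDistStructure.comp, LinDistStructure.ofMonoidal]
      comp_Lr := by simp [comp, id, ofMonoidal, LinDistStructure.comp, LinDistStructure.ofMonoidal]
      comp_Rl := by simp [comp, id, ofMonoidal, LinDistStructure.comp, LinDistStructure.ofMonoidal]
      comp_Rr := by simp [comp, id, ofMonoidal, LinDistStructure.comp, LinDistStructure.ofMonoidal] }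
    F.R.leftUnitor.hom_inv_id F.R.leftUnitor.inv_hom_id
    F.L.leftUnitor.hom_inv_id F.L.leftUnitor.inv_hom_id

/-- The right unit constraint; its components are identities. -/
def rightUnitor (F : LinDistFunctor C D) : F.comp (LinDistFunctor.id D) ≅ F :=
  isoOfTrans
    { ρ := F.R.rightUnitor.hom
      lam := F.L.rightUnitor.inv
      monoidal := inferInstanceAs (NatTrans.IsMonoidal F.R.rightUnitor.hom)
      comonoidal := IsComonoidalTrans.rightUnitor_inv F.L
      comp_Ll := by simp [comp, id, ofMonoidal, LinDistStructure.comp, LinDistStructure.ofMonoidal]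
      comp_Lr := by simp [comp, id, ofMonoidal, LinDistStructure.comp, LinDistStructure.ofMonoidal]
      comp_Rl := by simp [comp, id, ofMonoidal, LinDistStructure.comp, LinDistStructure.ofMonoidal]
      comp_Rr := by simp [comp, id, ofMonoidal, LinDistStructure.comp, LinDistStructure.ofMonoidal] }
    { ρ := F.R.rightUnitor.inv
      lam := F.L.rightUnitor.hom
      monoidal := inferInstanceAs (NatTrans.IsMonoidal F.R.rightUnitor.inv)
      comonoidal := IsComonoidalTrans.rightUnitor_hom F.L
      comp_Ll := by simp [comp, id, ofMonoidal, LinDistStructure.comp, LinDistStructure.ofMonoidal]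
      comp_Lr := by simp [comp, id, ofMonoidal, LinDistStructure.comp, LinDistStructure.ofMonoidal]
      comp_Rl := by simp [comp, id, ofMonoidal, LinDistStructure.comp, LinDistStructure.ofMonoidal]
      comp_Rr := by simp [comp, id, ofMonoidal, LinDistStructure.comp, LinDistStructure.ofMonoidal] }
    F.R.rightUnitor.hom_inv_id F.R.rightUnitor.inv_hom_id
    F.L.rightUnitor.hom_inv_id F.L.rightUnitor.inv_hom_id

end LinDistFunctor

/-- The type of monoidal categories, as objects of the 2-category of linearly distributive
functors. -/
structure MonLinDist where
  carrier : Type u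
  [category : Category.{v} carrier]
  [monoidalCategory : MonoidalCategory carrier]

attribute [instance] MonLinDist.category MonLinDist.monoidalCategory

attribute [local simp] LinDistFunctor.comp_ρ LinDistFunctor.comp_lam LinDistFunctor.id_ρ
  LinDistFunctor.id_lam LinDistFunctor.whiskerLeft LinDistFunctor.whiskerRight
  LinDistFunctor.associator LinDistFunctor.leftUnitor LinDistFunctor.rightUnitor
  LinDistFunctor.isoOfTrans LinDistFunctor.comp LinDistFunctor.id LinDistFunctor.ofMonoidal

/-- The 2-category of monoidal categories, linearly distributive functors and linearly
distributive natural transformations. -/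
instance : Bicategory MonLinDist.{v, u} where
  Hom C D := LinDistFunctor C.carrier D.carrier
  id C := LinDistFunctor.id C.carrier
  comp F G := LinDistFunctor.comp F G
  homCategory C D := inferInstanceAs (Category (LinDistFunctor C.carrier D.carrier))
  whiskerLeft F _ _ α := LinDistFunctor.whiskerLeft F α
  whiskerRight α H := LinDistFunctor.whiskerRight α H
  associator F G H := LinDistFunctor.associator F G H
  leftUnitor F := LinDistFunctor.leftUnitor F
  rightUnitor F := LinDistFunctor.rightUnitor F
  whiskerLeft_id := by intros; apply LinDistTrans.ext <;> (apply NatTrans.ext; funext X; simp)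
  whiskerLeft_comp := by intros; apply LinDistTrans.ext <;> (apply NatTrans.ext; funext X; simp)
  id_whiskerLeft := by intros; apply LinDistTrans.ext <;> (apply NatTrans.ext; funext X; simp)
  comp_whiskerLeft := by intros; apply LinDistTrans.ext <;> (apply NatTrans.ext; funext X; simp)
  id_whiskerRight := by intros; apply LinDistTrans.ext <;> (apply NatTrans.ext; funext X; simp)
  comp_whiskerRight := by intros; apply LinDistTrans.ext <;> (apply NatTrans.ext; funext X; simp)
  whiskerRight_id := by intros; apply LinDistTrans.ext <;> (apply NatTrans.ext; funext X; simp)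
  whiskerRight_comp := by intros; apply LinDistTrans.ext <;> (apply NatTrans.ext; funext X; simp)
  whisker_assoc := by intros; apply LinDistTrans.ext <;> (apply NatTrans.ext; funext X; simp)
  whisker_exchange := by intros; apply LinDistTrans.ext <;> (apply NatTrans.ext; funext X; simp)
  pentagon := by intros; apply LinDistTrans.ext <;> (apply NatTrans.ext; funext X; simp)
  triangle := by intros; apply LinDistTrans.ext <;> (apply NatTrans.ext; funext X; simp)

end TwoCategory

section HopfMonads

variable {C : Type u} [Category.{v} C] [MonoidalCategory C]

/-- A comonoidal monad: the unit and the multiplication are comonoidal. -/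
class IsComonoidalMonad (T : Monad C) [T.toFunctor.OplaxMonoidal] : Prop where
  unit : IsComonoidalTrans T.η
  mul : IsComonoidalTrans T.μ

/-- The left fusion operator of a comonoidal monad. -/
def leftFusion (T : Monad C) [T.toFunctor.OplaxMonoidal] (X Y : C) :
    T.obj (X ⊗ T.obj Y) ⟶ T.obj X ⊗ T.obj Y :=
  δ T.toFunctor X (T.obj Y) ≫ T.obj X ◁ T.μ.app Y

/-- The right fusion operator of a comonoidal monad. -/
def rightFusion (T : Monad C) [T.toFunctor.OplaxMonoidal] (X Y : C) :
    T.obj (T.obj X ⊗ Y) ⟶ T.obj X ⊗ T.obj Y :=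
  δ T.toFunctor (T.obj X) Y ≫ T.μ.app X ▷ T.obj Y

/-- A Hopf monad: a comonoidal monad which is both left and right Hopf. -/
structure IsHopfMonad (T : Monad C) [T.toFunctor.OplaxMonoidal] [IsComonoidalMonad T] : Prop where
  left (X Y : C) : IsIso (leftFusion T X Y)
  right (X Y : C) : IsIso (rightFusion T X Y)

/-- A monoidal comonad: the counit and the comultiplication are monoidal. -/
class IsMonoidalComonad (G : Comonad C) [G.toFunctor.LaxMonoidal] : Prop where
  counit : NatTrans.IsMonoidal G.ε
  comul : NatTrans.IsMonoidal G.δ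

/-- The left cofusion operator of a monoidal comonad. -/
def leftCofusion (G : Comonad C) [G.toFunctor.LaxMonoidal] (X Y : C) :
    G.obj X ⊗ G.obj Y ⟶ G.obj (X ⊗ G.obj Y) :=
  G.obj X ◁ G.δ.app Y ≫ μ G.toFunctor X (G.obj Y)

/-- The right cofusion operator of a monoidal comonad. -/
def rightCofusion (G : Comonad C) [G.toFunctor.LaxMonoidal] (X Y : C) :
    G.obj X ⊗ G.obj Y ⟶ G.obj (G.obj X ⊗ Y) :=
  G.δ.app X ▷ G.obj Y ≫ μ G.toFunctor (G.obj X) Y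

/-- A Hopf comonad: a monoidal comonad which is both left and right Hopf. -/
structure IsHopfComonad (G : Comonad C) [G.toFunctor.LaxMonoidal] [IsMonoidalComonad G] : Prop where
  left (X Y : C) : IsIso (leftCofusion G X Y)
  right (X Y : C) : IsIso (rightCofusion G X Y)

end HopfMonads

section RightAdjoint

variable {C : Type u} [Category.{v} C]

theorem eq_of_transpose_eq {D : Type u₁} [Category.{v₁} D] {F : C ⥤ D} {G : D ⥤ C} (adj : F ⊣ G)
    {A : C} {X : D} {f g : A ⟶ G.obj X}
    (h : F.map f ≫ adj.counit.app X = F.map g ≫ adj.counit.app X) : f = g :=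
  (adj.homEquiv A X).symm.injective (by simpa [Adjunction.homEquiv_counit] using h)

variable (T : Monad C) {G : C ⥤ C} (adj : T.toFunctor ⊣ G)

/-- The comultiplication `G ⟶ G ⋙ G` corresponding to `T.μ` under the adjunction. -/
abbrev rightComul : G ⟶ G ⋙ G := conjugateEquiv adj (adj.comp adj) T.μ

/-- The counit `G ⟶ 𝟭 C` corresponding to `T.η` under the adjunction. -/
abbrev rightCounit : G ⟶ 𝟭 C := conjugateEquiv adj Adjunction.id T.η

theorem rightCounit_app (X : C) :
    (rightCounit T adj).app X = T.η.app (G.obj X) ≫ adj.counit.app X := by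
  simp [rightCounit, conjugateEquiv_apply_app]

theorem transpose_rightComul (X : C) :
    T.map (T.map ((rightComul T adj).app X) ≫ adj.counit.app (G.obj X)) ≫ adj.counit.app X =
      T.μ.app (G.obj X) ≫ adj.counit.app X := by
  simp

theorem rightAct_assoc (X : C) :
    T.μ.app (G.obj X) ≫ T.map ((rightComul T adj).app X) ≫ adj.counit.app (G.obj X) =
      T.map (T.map ((rightComul T adj).app X) ≫ adj.counit.app (G.obj X)) ≫
        T.map ((rightComul T adj).app X) ≫ adj.counit.app (G.obj X) := by
  have h := transpose_rightComul T adj X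
  generalize (rightComul T adj).app X = d at h ⊢
  change G.obj X ⟶ G.obj (G.obj X) at d
  have h₂ := T.μ.naturality d
  dsimp at h₂
  apply eq_of_transpose_eq adj
  generalize hk : T.map d ≫ adj.counit.app (G.obj X) = k at h ⊢
  have h₃ := T.μ.naturality k
  dsimp at h₃
  rw [Functor.map_comp, Functor.map_comp, Category.assoc, Category.assoc, h, reassoc_of% h₃, h,
    ← Category.assoc, ← Category.assoc, T.assoc]

/-- The comonad structure on the right adjoint of a monad. -/
def rightComonad : Comonad C where
  toFunctor := G
  ε := rightCounit T adj
  δ := rightComul T adj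
  coassoc X := by
    have h := rightAct_assoc T adj X
    have ht := transpose_rightComul T adj (G.obj X)
    have h₁ := adj.counit_naturality ((rightComul T adj).app X)
    generalize (rightComul T adj).app X = d at h h₁ ⊢
    generalize (rightComul T adj).app (G.obj X) = d' at ht ⊢
    change G.obj X ⟶ G.obj (G.obj X) at d
    change G.obj (G.obj X) ⟶ G.obj (G.obj (G.obj X)) at d'
    have h₂ := T.μ.naturality d
    dsimp at h₁ h₂
    apply eq_of_transpose_eq adj
    apply eq_of_transpose_eq adj
    have e₁ : T.map (d ≫ G.map d) ≫ adj.counit.app (G.obj (G.obj X)) =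
        (T.map d ≫ adj.counit.app (G.obj X)) ≫ d := by
      rw [Functor.map_comp, Category.assoc, h₁, Category.assoc]
    have e₂ : T.map (d ≫ d') ≫ adj.counit.app (G.obj (G.obj X)) =
        T.map d ≫ T.map d' ≫ adj.counit.app (G.obj (G.obj X)) := by
      rw [Functor.map_comp, Category.assoc]
    refine (congrArg (fun k => T.map k ≫ adj.counit.app (G.obj X)) e₁).trans
      (Eq.trans ?_ (congrArg (fun k => T.map k ≫ adj.counit.app (G.obj X)) e₂).symm)
    rw [Functor.map_comp T.toFunctor _ d, Functor.map_comp T.toFunctor (T.map d) (T.map d' ≫ _),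
      Category.assoc, Category.assoc, ht, reassoc_of% h₂]
    exact h.symm
  left_counit X := by
    have h := transpose_rightComul T adj X
    rw [rightCounit_app]
    generalize (rightComul T adj).app X = d at h ⊢
    change G.obj X ⟶ G.obj (G.obj X) at d
    have h' := T.η.naturality d
    dsimp at h'
    apply eq_of_transpose_eq adj
    rw [reassoc_of% h', Functor.map_comp, Category.assoc, h, ← Category.assoc, T.right_unit]
    simp
  right_counit X := by
    have h := transpose_rightComul T adj X
    have h₂ := adj.counit_naturality ((rightCounit T adj).app X)
    rw [rightCounit_app] at h₂ ⊢
    generalize (rightComul T adj).app X = d at h ⊢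
    change G.obj X ⟶ G.obj (G.obj X) at d
    apply eq_of_transpose_eq adj
    dsimp at h₂ ⊢
    rw [Functor.map_comp, Category.assoc, h₂, ← Category.assoc]
    generalize T.map d ≫ adj.counit.app (G.obj X) = k at h ⊢
    have h' := T.η.naturality k
    dsimp at h'
    rw [reassoc_of% h', h, ← Category.assoc, T.left_unit]
    simp

theorem actionOfCoaction_unit {A : C} (c : A ⟶ G.obj A)
    (h : c ≫ (rightCounit T adj).app A = 𝟙 A) :
    T.η.app A ≫ T.map c ≫ adj.counit.app A = 𝟙 A := by
  have h₂ := T.η.naturality c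
  dsimp at h₂
  rw [rightCounit_app] at h
  rw [← reassoc_of% h₂]
  exact h

theorem actionOfCoaction_assoc {A : C} (c : A ⟶ G.obj A)
    (h₁ : c ≫ (rightComul T adj).app A = c ≫ G.map c) :
    T.μ.app A ≫ T.map c ≫ adj.counit.app A =
      T.map (T.map c ≫ adj.counit.app A) ≫ T.map c ≫ adj.counit.app A := by
  have h := transpose_rightComul T adj A
  have h₂ := T.μ.naturality c
  have h₃ := adj.counit_naturality c
  generalize (rightComul T adj).app A = d at h h₁
  change G.obj A ⟶ G.obj (G.obj A) at d
  change T.map (T.map c) ≫ T.μ.app (G.obj A) = T.μ.app A ≫ T.map c at h₂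
  have e : T.map c ≫ T.map d ≫ adj.counit.app (G.obj A) =
      (T.map c ≫ adj.counit.app A) ≫ c := by
    rw [← Functor.map_comp_assoc, h₁, Functor.map_comp, Category.assoc, h₃, Category.assoc]
  have h₅ := congrArg (fun k => T.map k ≫ adj.counit.app A) e
  rw [Functor.map_comp, Category.assoc, h, Functor.map_comp T.toFunctor _ c,
    Category.assoc] at h₅
  rw [← reassoc_of% h₂]
  exact h₅

theorem actionOfCoaction_hom {A B : C} (c : A ⟶ G.obj A) (d : B ⟶ G.obj B) (f : A ⟶ B)
    (h₁ : c ≫ G.map f = f ≫ d) :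
    T.map f ≫ T.map d ≫ adj.counit.app B = (T.map c ≫ adj.counit.app A) ≫ f := by
  have h₃ := adj.counit_naturality f
  rw [← Functor.map_comp_assoc, ← h₁, Functor.map_comp, Category.assoc, h₃, Category.assoc]

/-- The functor from coalgebras over the right adjoint `G` to `T`-algebras, the identity on
underlying objects and morphisms: a coaction `A ⟶ G A` corresponds to an action `T A ⟶ A`. -/
def coalgebraToAlgebra : (rightComonad T adj).Coalgebra ⥤ T.Algebra where
  obj A :=
    { A := A.A
      a := T.map (A.a : A.A ⟶ G.obj A.A) ≫ adj.counit.app A.A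
      unit := actionOfCoaction_unit T adj A.a A.counit
      assoc := actionOfCoaction_assoc T adj A.a A.coassoc }
  map {A B} f :=
    { f := f.f
      h := actionOfCoaction_hom T adj A.a B.a f.f f.h }

/-- The right adjoint `R^T` of the forgetful functor `U^T`, sending `X` to the object `G X` with
the `T`-algebra structure corresponding to its cofree `G`-coalgebra structure. -/
def coinduction : C ⥤ T.Algebra :=
  (rightComonad T adj).cofree ⋙ coalgebraToAlgebra T adj

theorem transpose_action {A : C} (a : T.obj A ⟶ A) :
    T.map (adj.homEquiv A A a) ≫ adj.counit.app A = a := by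
  exact (adj.homEquiv_counit _ _ _).symm.trans (Equiv.symm_apply_apply _ _)

theorem coinductionUnit_hom {A : C} (a : T.obj A ⟶ A) (h : T.μ.app A ≫ a = T.map a ≫ a) :
    T.map (adj.homEquiv A A a) ≫ T.map ((rightComul T adj).app A) ≫ adj.counit.app (G.obj A) =
      a ≫ adj.homEquiv A A a := by
  have h₁ := transpose_rightComul T adj A
  have h₂ := transpose_action T adj a
  generalize adj.homEquiv A A a = c at h₂ ⊢
  have h₃ := T.μ.naturality c
  dsimp at h₃
  generalize (rightComul T adj).app A = d at h₁ ⊢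
  change G.obj A ⟶ G.obj (G.obj A) at d
  change A ⟶ G.obj A at c
  apply eq_of_transpose_eq adj
  rw [Functor.map_comp, Category.assoc, h₁, Functor.map_comp, Category.assoc, h₂,
    reassoc_of% h₃, h₂, h]

/-- The unit of the adjunction `U^T ⊣ R^T`: at an algebra `(A, a)` it is the morphism `A ⟶ G A`
corresponding to `a : T A ⟶ A`. -/
def coinductionUnit : 𝟭 T.Algebra ⟶ T.forget ⋙ coinduction T adj where
  app A :=
    { f := adj.homEquiv A.A A.A A.a
      h := coinductionUnit_hom T adj A.a A.assoc }
  naturality A B f := by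
    apply Monad.Algebra.Hom.ext'
    change f.f ≫ adj.homEquiv B.A B.A B.a = adj.homEquiv A.A A.A A.a ≫ G.map f.f
    rw [← Adjunction.homEquiv_naturality_left, ← Adjunction.homEquiv_naturality_right, f.h]

/-- The adjunction `U^T ⊣ R^T`. Its counit is the counit of the comonad `G`. -/
def forgetAdjCoinduction : T.forget ⊣ coinduction T adj :=
  Adjunction.mkOfUnitCounit
    { unit := coinductionUnit T adj
      counit := (rightComonad T adj).ε
      left_triangle := by
        apply NatTrans.ext
        funext A
        have h := rightCounit_app T adj A.A
        have h₁ := T.η.naturality (adj.homEquiv A.A A.A A.a)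
        have h₂ := transpose_action T adj A.a
        have h₃ := A.unit
        change adj.homEquiv A.A A.A A.a ≫ 𝟙 _ ≫ (rightCounit T adj).app A.A = 𝟙 _
        dsimp at h₁
        rw [Category.id_comp, h, reassoc_of% h₁, h₂, h₃]
      right_triangle := by
        apply NatTrans.ext
        funext X
        apply Monad.Algebra.Hom.ext'
        change adj.homEquiv (G.obj X) (G.obj X)
          (T.map ((rightComul T adj).app X) ≫ adj.counit.app (G.obj X)) ≫ 𝟙 _ ≫
            G.map ((rightCounit T adj).app X) = 𝟙 _
        have h := (rightComonad T adj).right_counit X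
        rw [← Adjunction.homEquiv_counit]
        change (rightComul T adj).app X ≫ G.map ((rightCounit T adj).app X) = _ at h
        rw [Equiv.apply_symm_apply, Category.id_comp]
        exact h }

end RightAdjoint

section MonoidalAlgebras

variable {C : Type u} [Category.{v} C] [MonoidalCategory C]

section Algebras

variable (T : Monad C) [T.toFunctor.OplaxMonoidal] [h : IsComonoidalMonad T]

theorem eta_unit : T.η.app (𝟙_ C) ≫ η T.toFunctor = 𝟙 (𝟙_ C) :=
  h.unit.counit

theorem eta_tensor (X Y : C) :
    T.η.app (X ⊗ Y) ≫ δ T.toFunctor X Y = (T.η.app X ⊗ₘ T.η.app Y) :=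
  (h.unit.cotensor X Y).trans (by simp)

theorem mu_unit : T.μ.app (𝟙_ C) ≫ η T.toFunctor = T.map (η T.toFunctor) ≫ η T.toFunctor :=
  h.mul.counit.trans (by simp)

theorem mu_tensor (X Y : C) :
    T.μ.app (X ⊗ Y) ≫ δ T.toFunctor X Y =
      T.map (δ T.toFunctor X Y) ≫ δ T.toFunctor (T.obj X) (T.obj Y) ≫
        (T.μ.app X ⊗ₘ T.μ.app Y) :=
  (h.mul.cotensor X Y).trans (by simp)

/-- The unit algebra, with action `T 𝟙 ⟶ 𝟙`. -/
def algebraUnit : T.Algebra where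
  A := 𝟙_ C
  a := η T.toFunctor
  unit := eta_unit T
  assoc := mu_unit T

variable {T}

/-- The tensor product of algebras, with action `T (A ⊗ B) ⟶ T A ⊗ T B ⟶ A ⊗ B`. -/
def algebraTensor (A B : T.Algebra) : T.Algebra where
  A := A.A ⊗ B.A
  a := δ T.toFunctor A.A B.A ≫ (A.a ⊗ₘ B.a)
  unit := by
    rw [reassoc_of% (eta_tensor T A.A B.A), tensorHom_comp_tensorHom, A.unit, B.unit,
      id_tensorHom_id]
  assoc := by
    rw [reassoc_of% (mu_tensor T A.A B.A), tensorHom_comp_tensorHom, A.assoc, B.assoc,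
      Functor.map_comp, Category.assoc, ← δ_natural_assoc, tensorHom_comp_tensorHom]

/-- The tensor product of algebra morphisms. -/
def algebraTensorHom {A A' B B' : T.Algebra} (f : A ⟶ A') (g : B ⟶ B') :
    algebraTensor A B ⟶ algebraTensor A' B' where
  f := f.f ⊗ₘ g.f
  h := by
    dsimp [algebraTensor]
    rw [← δ_natural_assoc, tensorHom_comp_tensorHom, f.h, g.h, Category.assoc,
      tensorHom_comp_tensorHom]

instance : MonoidalCategoryStruct T.Algebra where
  tensorObj A B := algebraTensor A B
  tensorUnit := algebraUnit T
  tensorHom f g := algebraTensorHom f g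
  whiskerLeft A _ _ g := algebraTensorHom (𝟙 A) g
  whiskerRight f B := algebraTensorHom f (𝟙 B)
  associator A B D := Monad.Algebra.isoMk (α_ A.A B.A D.A) (by
    have e := Functor.OplaxMonoidal.associativity (F := T.toFunctor) A.A B.A D.A
    have e₁ : (A.a ⊗ₘ δ T.toFunctor B.A D.A ≫ (B.a ⊗ₘ D.a)) =
        T.obj A.A ◁ δ T.toFunctor B.A D.A ≫ (A.a ⊗ₘ (B.a ⊗ₘ D.a)) := by
      rw [← id_tensorHom, tensorHom_comp_tensorHom, Category.id_comp]
    have e₂ : ((δ T.toFunctor A.A B.A ≫ (A.a ⊗ₘ B.a)) ⊗ₘ D.a) =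
        δ T.toFunctor A.A B.A ▷ T.obj D.A ≫ ((A.a ⊗ₘ B.a) ⊗ₘ D.a) := by
      rw [← tensorHom_id, tensorHom_comp_tensorHom, Category.id_comp]
    dsimp [algebraTensor]
    rw [e₁, e₂, Category.assoc, Category.assoc, associator_naturality, reassoc_of% e])
  leftUnitor A := Monad.Algebra.isoMk (λ_ A.A) (by
    have e := Functor.OplaxMonoidal.left_unitality_hom (F := T.toFunctor) A.A
    dsimp [algebraTensor, algebraUnit]
    rw [MonoidalCategory.tensorHom_def, Category.assoc, Category.assoc, leftUnitor_naturality,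
      reassoc_of% e])
  rightUnitor A := Monad.Algebra.isoMk (ρ_ A.A) (by
    have e := Functor.OplaxMonoidal.right_unitality_hom (F := T.toFunctor) A.A
    dsimp [algebraTensor, algebraUnit]
    rw [MonoidalCategory.tensorHom_def', Category.assoc, Category.assoc, rightUnitor_naturality,
      reassoc_of% e])

/-- The data showing that the monoidal structure of `T.Algebra` is lifted strictly along the
forgetful functor. -/
def forgetInducingData : Monoidal.InducingFunctorData T.forget where
  μIso A B := Iso.refl (A.A ⊗ B.A)
  εIso := Iso.refl (𝟙_ C)
  whiskerLeft_eq A _ _ g := by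
    change (𝟙 A.A ⊗ₘ g.f) = 𝟙 _ ≫ (A.A ◁ g.f) ≫ 𝟙 _
    simp
  whiskerRight_eq f B := by
    change (f.f ⊗ₘ 𝟙 B.A) = 𝟙 _ ≫ (f.f ▷ B.A) ≫ 𝟙 _
    simp
  tensorHom_eq f g := by
    change (f.f ⊗ₘ g.f) = 𝟙 _ ≫ (f.f ⊗ₘ g.f) ≫ 𝟙 _
    simp
  associator_eq A B D := by
    change (α_ A.A B.A D.A).hom =
      (𝟙 ((A.A ⊗ B.A) ⊗ D.A) ≫ (𝟙 (A.A ⊗ B.A) ⊗ₘ 𝟙 D.A)) ≫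
      (α_ A.A B.A D.A).hom ≫ (𝟙 A.A ⊗ₘ 𝟙 (B.A ⊗ D.A)) ≫ 𝟙 (A.A ⊗ B.A ⊗ D.A)
    simp
  leftUnitor_eq A := by
    change (λ_ A.A).hom =
      (𝟙 (𝟙_ C ⊗ A.A) ≫ (𝟙 (𝟙_ C) ⊗ₘ 𝟙 A.A)) ≫ (λ_ A.A).hom
    simp
  rightUnitor_eq A := by
    change (ρ_ A.A).hom =
      (𝟙 (A.A ⊗ 𝟙_ C) ≫ (𝟙 A.A ⊗ₘ 𝟙 (𝟙_ C))) ≫ (ρ_ A.A).hom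
    simp

/-- The monoidal category of algebras over a comonoidal monad. -/
instance : MonoidalCategory T.Algebra :=
  Monoidal.induced T.forget forgetInducingData

/-- The forgetful functor is strict monoidal: its structure morphisms are identities. -/
instance : T.forget.Monoidal :=
  Monoidal.fromInducedMonoidal T.forget forgetInducingData


/-- The free functor is comonoidal, being left adjoint to the monoidal forgetful functor. -/
instance : T.free.OplaxMonoidal :=
  T.adj.leftAdjointOplaxMonoidal

end Algebras

section Coinduction

variable (T : Monad C) [T.toFunctor.OplaxMonoidal] {G : C ⥤ C} (adj : T.toFunctor ⊣ G)

/-- The right adjoint of a comonoidal functor is monoidal. -/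
instance : (rightComonad T adj).toFunctor.LaxMonoidal :=
  adj.rightAdjointLaxMonoidal

theorem isMonoidal_conjugate {D : Type u₁} [Category.{v₁} D] [MonoidalCategory D]
    {L₁ L₂ : C ⥤ D} {R₁ R₂ : D ⥤ C} [L₁.OplaxMonoidal] [L₂.OplaxMonoidal] [R₁.LaxMonoidal]
    [R₂.LaxMonoidal] (adj₁ : L₁ ⊣ R₁) (adj₂ : L₂ ⊣ R₂) [adj₁.IsMonoidal] [adj₂.IsMonoidal]
    (τ : L₂ ⟶ L₁) (h : IsComonoidalTrans τ) :
    NatTrans.IsMonoidal (conjugateEquiv adj₁ adj₂ τ) where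
  unit := by
    apply eq_of_transpose_eq adj₂
    have h₁ := adj₁.map_ε_comp_counit_app_unit
    have h₂ := adj₂.map_ε_comp_counit_app_unit
    have h₃ := h.counit
    have h₄ := conjugateEquiv_counit adj₁ adj₂ τ (𝟙_ D)
    have h₅ := τ.naturality (ε R₁)
    rw [Functor.map_comp, Category.assoc, h₄, reassoc_of% h₅, h₁, h₂, h₃]
  tensor X Y := by
    apply eq_of_transpose_eq adj₂
    have h₁ := adj₁.map_μ_comp_counit_app_tensor X Y
    have h₂ := adj₂.map_μ_comp_counit_app_tensor X Y
    have h₃ := h.cotensor (R₁.obj X) (R₁.obj Y)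
    have h₄ := conjugateEquiv_counit adj₁ adj₂ τ
    have h₅ := τ.naturality (μ R₁ X Y)
    rw [Functor.map_comp, Category.assoc, h₄, reassoc_of% h₅, h₁, Functor.map_comp,
      Category.assoc, h₂, ← δ_natural_assoc, reassoc_of% h₃, tensorHom_comp_tensorHom,
      tensorHom_comp_tensorHom, h₄, h₄]

instance [h : IsComonoidalMonad T] : IsMonoidalComonad (rightComonad T adj) := by
  let _ : G.LaxMonoidal := adj.rightAdjointLaxMonoidal
  exact
    { counit := isMonoidal_conjugate adj Adjunction.id T.η h.unit
      comul := isMonoidal_conjugate adj (adj.comp adj) T.μ h.mul }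

variable [IsComonoidalMonad T]

/-- The functor `R^T` is monoidal, being right adjoint to the strong monoidal forgetful functor. -/
instance : (coinduction T adj).LaxMonoidal :=
  (forgetAdjCoinduction T adj).rightAdjointLaxMonoidal

/-- A biHopf monad: a Hopf monad whose right adjoint comonad is a Hopf comonad. -/
structure IsBiHopfMonad : Prop where
  hopf : IsHopfMonad T
  coHopf : IsHopfComonad (rightComonad T adj)

end Coinduction

end MonoidalAlgebras

section Pairs

variable {C : Type (max u v)} [Category.{v} C] [MonoidalCategory C]

/-- A monoidal category, as an object of the 2-category `MonLinDist`. -/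
abbrev MonLinDist.of (C : Type u) [Category.{v} C] [MonoidalCategory C] : MonLinDist.{v, u} :=
  ⟨C⟩

variable (T : Monad C) [T.toFunctor.OplaxMonoidal]

/-- The linearly distributive functor `(U^T, U^T)` given by the strong monoidal forgetful
functor. -/
def forgetPair [IsComonoidalMonad T] :
    MonLinDist.of.{v, max u v} T.Algebra ⟶ MonLinDist.of.{v, max u v} C :=
  LinDistFunctor.ofMonoidal T.forget

variable {G : C ⥤ C} (adj : T.toFunctor ⊣ G)

/-- The pair `(R^T, L^T)` with given strengths and costrengths. -/
def coinductionFreePair [IsComonoidalMonad T]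
    (s : LinDistStructure (coinduction T adj) T.free) :
    MonLinDist.of.{v, max u v} C ⟶ MonLinDist.of.{v, max u v} T.Algebra :=
  LinDistFunctor.mk (coinduction T adj) T.free s

/-- The pair `(G, T)` with given strengths and costrengths. -/
def comonadMonadPair (s : LinDistStructure (rightComonad T adj).toFunctor T.toFunctor) :
    MonLinDist.of.{v, max u v} C ⟶ MonLinDist.of.{v, max u v} C :=
  LinDistFunctor.mk (rightComonad T adj).toFunctor T.toFunctor s

end Pairs

/-! The forgetful functor `U` is strong monoidal and is the middle of an adjoint triple `L ⊣ U ⊣ R`,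
with `L` comonoidal and `R` monoidal. The proof rests on the Hopf operators `L (X ⊗ U A) ⟶ L X ⊗ A`
and `L (U A ⊗ X) ⟶ A ⊗ L X`, and on their duals `R X ⊗ A ⟶ R (X ⊗ U A)` and `A ⊗ R X ⟶ R (U A ⊗ X)`.

Suppose that all four families are invertible. A costrength is then an inverse Hopf operator
followed by `L` of the counit of `U ⊣ R`; a strength is `R` of the unit of `L ⊣ U` followed by an
inverse dual operator. Composing an axiom of `LinDistStructure` with suitable Hopf operators removes
the inverses and leaves an identity between units, counits and coherence maps of `U`
(`hopfTripleStructure`). The same cancellation shows that the unit of `U ⊣ R` paired with the counit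
of `L ⊣ U` is a linearly distributive transformation; for the other pair, transposes of the
strengths and costrengths suffice. The triangle identities in `MonLinDist` are those of the two
ordinary adjunctions, one in each component (`hopfTripleAdjunction`).

For a biHopf monad, the fusion operators are the Hopf operators at free algebras, and the cofusion
operators are the dual ones at the algebras `R Y`. Invertibility spreads to all algebras because `U
A` is a split coequalizer of underlying free objects, and dually a split equalizer
(`isIso_app_of_isIso_app_leftAdjoint`, `isIso_app_of_isIso_app_rightAdjoint`). This is
`IsBiHopfMonad.isHopfTriple`.

The adjunction induces a comonad on the composite pair. Its functors are `G` and `T` themselves, and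
its monoidal and comonoidal structures agree with the given ones by a computation of mates, so it
can be transported to `(G, T)` along identity components. -/

/-! ### Units and counits of monoidal adjunctions, componentwise. -/

section AdjunctionComponents

variable {C : Type u₁} [Category.{v₁} C] {D : Type u₂} [Category.{v₂} D]
  {F : C ⥤ D} {U : D ⥤ C} (adj : F ⊣ U)

/-- The component of the unit of an adjunction, with composite functors unfolded in its type. -/
def adjUnit (X : C) : X ⟶ U.obj (F.obj X) := adj.unit.app X

/-- The component of the counit of an adjunction, with composite functors unfolded in its type. -/
def adjCounit (A : D) : F.obj (U.obj A) ⟶ A := adj.counit.app A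

theorem adjUnit_naturality {X X' : C} (f : X ⟶ X') :
    f ≫ adjUnit adj X' = adjUnit adj X ≫ U.map (F.map f) :=
  adj.unit.naturality f

theorem adjCounit_naturality {A A' : D} (g : A ⟶ A') :
    F.map (U.map g) ≫ adjCounit adj A' = adjCounit adj A ≫ g :=
  adj.counit.naturality g

theorem map_adjUnit_comp_adjCounit (X : C) :
    F.map (adjUnit adj X) ≫ adjCounit adj (F.obj X) = 𝟙 (F.obj X) :=
  adj.left_triangle_components X

theorem adjUnit_comp_map_adjCounit (A : D) :
    adjUnit adj (U.obj A) ≫ U.map (adjCounit adj A) = 𝟙 (U.obj A) :=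
  adj.right_triangle_components A

variable [MonoidalCategory C] [MonoidalCategory D] [F.OplaxMonoidal] [U.LaxMonoidal]
  [adj.IsMonoidal]

theorem adjUnit_unit_comp_map_η : adjUnit adj (𝟙_ C) ≫ U.map (η F) = ε U :=
  adj.unit_app_unit_comp_map_η

theorem map_ε_comp_adjCounit_unit : F.map (ε U) ≫ adjCounit adj (𝟙_ D) = η F :=
  adj.map_ε_comp_counit_app_unit

theorem adjUnit_tensor_comp_map_δ (X Y : C) :
    adjUnit adj (X ⊗ Y) ≫ U.map (δ F X Y) =
      (adjUnit adj X ⊗ₘ adjUnit adj Y) ≫ μ U (F.obj X) (F.obj Y) :=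
  adj.unit_app_tensor_comp_map_δ X Y

theorem map_μ_comp_adjCounit_tensor (A B : D) :
    F.map (μ U A B) ≫ adjCounit adj (A ⊗ B) =
      δ F (U.obj A) (U.obj B) ≫ (adjCounit adj A ⊗ₘ adjCounit adj B) :=
  adj.map_μ_comp_counit_app_tensor A B

end AdjunctionComponents

/-! ### Hopf operators of a comonoidal adjunction and of a monoidal adjunction. -/

section HopfOperators

variable {C : Type u₁} [Category.{v₁} C] [MonoidalCategory C]
  {D : Type u₂} [Category.{v₂} D] [MonoidalCategory D]

section Left

variable {L : C ⥤ D} {U : D ⥤ C} [L.OplaxMonoidal] (adj : L ⊣ U)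

/-- The left Hopf operator of an adjunction `L ⊣ U` with `L` comonoidal. -/
def hopfLeft (X : C) (A : D) : L.obj (X ⊗ U.obj A) ⟶ L.obj X ⊗ A :=
  δ L X (U.obj A) ≫ L.obj X ◁ adjCounit adj A

/-- The right Hopf operator of an adjunction `L ⊣ U` with `L` comonoidal. -/
def hopfRight (A : D) (X : C) : L.obj (U.obj A ⊗ X) ⟶ A ⊗ L.obj X :=
  δ L (U.obj A) X ≫ adjCounit adj A ▷ L.obj X

theorem hopfLeft_naturality_left {X X' : C} (f : X ⟶ X') (A : D) :
    L.map (f ▷ U.obj A) ≫ hopfLeft adj X' A = hopfLeft adj X A ≫ L.map f ▷ A := by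
  simp only [hopfLeft, ← δ_natural_left_assoc, Category.assoc, whisker_exchange]

theorem hopfLeft_naturality_right (X : C) {A A' : D} (g : A ⟶ A') :
    L.map (X ◁ U.map g) ≫ hopfLeft adj X A' = hopfLeft adj X A ≫ L.obj X ◁ g := by
  simp only [hopfLeft, ← δ_natural_right_assoc, Category.assoc,
    ← MonoidalCategory.whiskerLeft_comp, adjCounit_naturality]

theorem hopfRight_naturality_left {A A' : D} (g : A ⟶ A') (X : C) :
    L.map (U.map g ▷ X) ≫ hopfRight adj A' X = hopfRight adj A X ≫ g ▷ L.obj X := by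
  simp only [hopfRight, ← δ_natural_left_assoc, Category.assoc, ← comp_whiskerRight,
    adjCounit_naturality]

theorem hopfRight_naturality_right (A : D) {X X' : C} (f : X ⟶ X') :
    L.map (U.obj A ◁ f) ≫ hopfRight adj A X' = hopfRight adj A X ≫ A ◁ L.map f := by
  simp only [hopfRight, ← δ_natural_right_assoc, Category.assoc, whisker_exchange]

/-- By a triangle identity, the Hopf operator at `L Y` knows the comonoidal structure. This lets `δ
L` be traded for a Hopf operator in the axioms mixing strengths and costrengths. -/
theorem map_adjUnit_comp_hopfLeft (X Y : C) :
    L.map (X ◁ adjUnit adj Y) ≫ hopfLeft adj X (L.obj Y) = δ L X Y := by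
  rw [hopfLeft, ← δ_natural_right_assoc, ← MonoidalCategory.whiskerLeft_comp,
    map_adjUnit_comp_adjCounit, MonoidalCategory.whiskerLeft_id, Category.comp_id]

theorem map_adjUnit_comp_hopfRight (X Y : C) :
    L.map (adjUnit adj X ▷ Y) ≫ hopfRight adj (L.obj X) Y = δ L X Y := by
  rw [hopfRight, ← δ_natural_left_assoc, ← comp_whiskerRight,
    map_adjUnit_comp_adjCounit, id_whiskerRight, Category.comp_id]

/-- Coassociativity of `δ L`, with the counit carried along in the last factor. -/
theorem hopfLeft_comp_δ (X Y : C) (A : D) :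
    hopfLeft adj (X ⊗ Y) A ≫ δ L X Y ▷ A ≫ (α_ _ _ _).hom =
      L.map (α_ _ _ _).hom ≫ δ L X (Y ⊗ U.obj A) ≫ L.obj X ◁ hopfLeft adj Y A := by
  simp only [hopfLeft, Category.assoc, MonoidalCategory.whiskerLeft_comp]
  rw [whisker_exchange_assoc, ← Functor.OplaxMonoidal.associativity_assoc,
    associator_naturality_right]

theorem hopfRight_comp_δ (A : D) (X Y : C) :
    hopfRight adj A (X ⊗ Y) ≫ A ◁ δ L X Y ≫ (α_ _ _ _).inv =
      L.map (α_ _ _ _).inv ≫ δ L (U.obj A ⊗ X) Y ≫ hopfRight adj A X ▷ L.obj Y := by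
  simp only [hopfRight, Category.assoc, comp_whiskerRight]
  rw [← whisker_exchange_assoc, ← Functor.OplaxMonoidal.associativity_inv_assoc,
    associator_inv_naturality_left]

/-- The two operators act at opposite ends of a triple tensor product, so coassociativity and the
interchange law suffice. This is the source of the axiom `bi_L`. -/
theorem hopfLeft_comp_hopfRight (A : D) (X : C) (B : D) :
    hopfLeft adj (U.obj A ⊗ X) B ≫ hopfRight adj A X ▷ B ≫ (α_ _ _ _).hom =
      L.map (α_ _ _ _).hom ≫ hopfRight adj A (X ⊗ U.obj B) ≫ A ◁ hopfLeft adj X B := by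
  simp only [hopfLeft, hopfRight, Category.assoc, MonoidalCategory.whiskerLeft_comp,
    comp_whiskerRight]
  rw [whisker_exchange_assoc, whisker_exchange_assoc, associator_naturality_right,
    associator_naturality_left_assoc, Functor.OplaxMonoidal.associativity_assoc,
    ← whisker_exchange_assoc]

variable [U.Monoidal] [adj.IsMonoidal]

theorem hopfLeft_comp_adjCounit (A B : D) :
    hopfLeft adj (U.obj A) B ≫ adjCounit adj A ▷ B =
      L.map (μ U A B) ≫ adjCounit adj (A ⊗ B) := by
  rw [map_μ_comp_adjCounit_tensor, MonoidalCategory.tensorHom_def', hopfLeft, Category.assoc]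

theorem hopfRight_comp_adjCounit (A B : D) :
    hopfRight adj A (U.obj B) ≫ A ◁ adjCounit adj B =
      L.map (μ U A B) ≫ adjCounit adj (A ⊗ B) := by
  rw [map_μ_comp_adjCounit_tensor, MonoidalCategory.tensorHom_def, hopfRight, Category.assoc]

/-- Identifies the transpose of the Hopf operator under `L ⊣ U`; it involves no comonoidal
structure, only the unit and `μ U`. -/
theorem adjUnit_comp_map_hopfLeft (X : C) (A : D) :
    adjUnit adj (X ⊗ U.obj A) ≫ U.map (hopfLeft adj X A) =
      adjUnit adj X ▷ U.obj A ≫ μ U (L.obj X) A := by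
  rw [hopfLeft, Functor.map_comp, reassoc_of% @adjUnit_tensor_comp_map_δ, ← μ_natural_right,
    MonoidalCategory.tensorHom_def, Category.assoc, ← MonoidalCategory.whiskerLeft_comp_assoc,
    adjUnit_comp_map_adjCounit, MonoidalCategory.whiskerLeft_id, Category.id_comp]

theorem adjUnit_comp_map_hopfRight (A : D) (X : C) :
    adjUnit adj (U.obj A ⊗ X) ≫ U.map (hopfRight adj A X) =
      U.obj A ◁ adjUnit adj X ≫ μ U A (L.obj X) := by
  rw [hopfRight, Functor.map_comp, reassoc_of% @adjUnit_tensor_comp_map_δ, ← μ_natural_left,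
    MonoidalCategory.tensorHom_def', Category.assoc, ← comp_whiskerRight_assoc,
    adjUnit_comp_map_adjCounit, id_whiskerRight, Category.id_comp]

/-- A tensor product can be extracted one factor at a time: the counit at `A ⊗ B` splits through `δ
L` because the adjunction is monoidal, and coassociativity rearranges the rest. -/
theorem map_α_comp_hopfLeft_tensor (X : C) (A B : D) :
    L.map (α_ _ _ _).hom ≫ L.map (X ◁ μ U A B) ≫ hopfLeft adj X (A ⊗ B) =
      hopfLeft adj (X ⊗ U.obj A) B ≫ hopfLeft adj X A ▷ B ≫ (α_ _ _ _).hom := by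
  have h : hopfLeft adj X A ▷ B =
      δ L X (U.obj A) ▷ B ≫ (L.obj X ◁ adjCounit adj A) ▷ B := by
    rw [hopfLeft, comp_whiskerRight]
  rw [h, Category.assoc, associator_naturality_middle, reassoc_of% @hopfLeft_comp_δ,
    ← MonoidalCategory.whiskerLeft_comp, hopfLeft_comp_adjCounit,
    MonoidalCategory.whiskerLeft_comp, δ_natural_right_assoc, hopfLeft]

theorem map_α_comp_hopfRight_tensor (A B : D) (X : C) :
    L.map (α_ _ _ _).inv ≫ L.map (μ U A B ▷ X) ≫ hopfRight adj (A ⊗ B) X =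
      hopfRight adj A (U.obj B ⊗ X) ≫ A ◁ hopfRight adj B X ≫ (α_ _ _ _).inv := by
  have h : A ◁ hopfRight adj B X =
      A ◁ δ L (U.obj B) X ≫ A ◁ (adjCounit adj B ▷ L.obj X) := by
    rw [hopfRight, MonoidalCategory.whiskerLeft_comp]
  rw [h, Category.assoc, associator_inv_naturality_middle, reassoc_of% @hopfRight_comp_δ,
    ← comp_whiskerRight, hopfRight_comp_adjCounit,
    comp_whiskerRight, δ_natural_left_assoc, hopfRight]

theorem map_ε_comp_hopfLeft_unit (X : C) :
    L.map (X ◁ ε U) ≫ hopfLeft adj X (𝟙_ D) ≫ (ρ_ _).hom = L.map (ρ_ X).hom := by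
  rw [hopfLeft, Category.assoc, ← δ_natural_right_assoc,
    ← MonoidalCategory.whiskerLeft_comp_assoc, map_ε_comp_adjCounit_unit,
    right_unitality_hom]

theorem map_ε_comp_hopfRight_unit (X : C) :
    L.map (ε U ▷ X) ≫ hopfRight adj (𝟙_ D) X ≫ (λ_ _).hom = L.map (λ_ X).hom := by
  rw [hopfRight, Category.assoc, ← δ_natural_left_assoc,
    ← comp_whiskerRight_assoc, map_ε_comp_adjCounit_unit,
    left_unitality_hom]

theorem hopfLeft_tensor (X : C) (A B : D) :
    hopfLeft adj X (A ⊗ B) ≫ (α_ _ _ _).inv = L.map (X ◁ δ U A B) ≫ L.map (α_ _ _ _).inv ≫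
      hopfLeft adj (X ⊗ U.obj A) B ≫ hopfLeft adj X A ▷ B := by
  rw [Iso.comp_inv_eq, Category.assoc, Category.assoc, Category.assoc,
    ← map_α_comp_hopfLeft_tensor, ← Functor.map_comp_assoc, ← Functor.map_comp_assoc,
    ← Functor.map_comp_assoc, Category.assoc, Category.assoc, Iso.inv_hom_id_assoc,
    ← MonoidalCategory.whiskerLeft_comp,
    Functor.Monoidal.δ_μ]
  simp

theorem hopfRight_tensor (A B : D) (X : C) :
    hopfRight adj (A ⊗ B) X ≫ (α_ _ _ _).hom = L.map (δ U A B ▷ X) ≫ L.map (α_ _ _ _).hom ≫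
      hopfRight adj A (U.obj B ⊗ X) ≫ A ◁ hopfRight adj B X := by
  rw [← Iso.eq_comp_inv, Category.assoc, Category.assoc, Category.assoc,
    ← map_α_comp_hopfRight_tensor, ← Functor.map_comp_assoc, ← Functor.map_comp_assoc,
    ← Functor.map_comp_assoc, Category.assoc, Category.assoc, Iso.hom_inv_id_assoc,
    ← comp_whiskerRight,
    Functor.Monoidal.δ_μ]
  simp

theorem hopfLeft_unit (X : C) :
    hopfLeft adj X (𝟙_ D) ≫ (ρ_ _).hom = L.map (X ◁ η U) ≫ L.map (ρ_ X).hom := by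
  rw [← map_ε_comp_hopfLeft_unit adj X, ← Functor.map_comp_assoc,
    ← MonoidalCategory.whiskerLeft_comp, Functor.Monoidal.η_ε]
  simp

theorem hopfRight_unit (X : C) :
    hopfRight adj (𝟙_ D) X ≫ (λ_ _).hom = L.map (η U ▷ X) ≫ L.map (λ_ X).hom := by
  rw [← map_ε_comp_hopfRight_unit adj X, ← Functor.map_comp_assoc,
    ← comp_whiskerRight, Functor.Monoidal.η_ε]
  simp

end Left

/-! ### The dual operators, for a right adjoint `R` of `U`. -/

section Right

variable {R : C ⥤ D} {U : D ⥤ C} [R.LaxMonoidal] (adj : U ⊣ R)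

/-- The left Hopf operator of an adjunction `U ⊣ R` with `R` monoidal. -/
def cohopfLeft (X : C) (A : D) : R.obj X ⊗ A ⟶ R.obj (X ⊗ U.obj A) :=
  R.obj X ◁ adjUnit adj A ≫ μ R X (U.obj A)

/-- The right Hopf operator of an adjunction `U ⊣ R` with `R` monoidal. -/
def cohopfRight (A : D) (X : C) : A ⊗ R.obj X ⟶ R.obj (U.obj A ⊗ X) :=
  adjUnit adj A ▷ R.obj X ≫ μ R (U.obj A) X

theorem cohopfLeft_naturality_left {X X' : C} (f : X ⟶ X') (A : D) :
    R.map f ▷ A ≫ cohopfLeft adj X' A = cohopfLeft adj X A ≫ R.map (f ▷ U.obj A) := by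
  simp only [cohopfLeft, ← μ_natural_left, Category.assoc, whisker_exchange_assoc]

theorem cohopfLeft_naturality_right (X : C) {A A' : D} (g : A ⟶ A') :
    R.obj X ◁ g ≫ cohopfLeft adj X A' = cohopfLeft adj X A ≫ R.map (X ◁ U.map g) := by
  simp only [cohopfLeft, ← μ_natural_right, Category.assoc,
    ← MonoidalCategory.whiskerLeft_comp_assoc, adjUnit_naturality]

theorem cohopfRight_naturality_left {A A' : D} (g : A ⟶ A') (X : C) :
    g ▷ R.obj X ≫ cohopfRight adj A' X = cohopfRight adj A X ≫ R.map (U.map g ▷ X) := by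
  simp only [cohopfRight, ← μ_natural_left, Category.assoc, ← comp_whiskerRight_assoc,
    adjUnit_naturality]

theorem cohopfRight_naturality_right (A : D) {X X' : C} (f : X ⟶ X') :
    A ◁ R.map f ≫ cohopfRight adj A X' = cohopfRight adj A X ≫ R.map (U.obj A ◁ f) := by
  simp only [cohopfRight, ← μ_natural_right, Category.assoc, whisker_exchange_assoc]

/-- Dual to `map_adjUnit_comp_hopfLeft`: here the monoidal structure of `R` is recovered from the
operator at `R Y`. -/
theorem cohopfLeft_comp_map_adjCounit (X Y : C) :
    cohopfLeft adj X (R.obj Y) ≫ R.map (X ◁ adjCounit adj Y) = μ R X Y := by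
  rw [cohopfLeft, Category.assoc, ← μ_natural_right, ← MonoidalCategory.whiskerLeft_comp_assoc,
    adjUnit_comp_map_adjCounit, MonoidalCategory.whiskerLeft_id, Category.id_comp]

theorem cohopfRight_comp_map_adjCounit (X Y : C) :
    cohopfRight adj (R.obj X) Y ≫ R.map (adjCounit adj X ▷ Y) = μ R X Y := by
  rw [cohopfRight, Category.assoc, ← μ_natural_left, ← comp_whiskerRight_assoc,
    adjUnit_comp_map_adjCounit, id_whiskerRight, Category.id_comp]

theorem μ_comp_cohopfLeft (X Y : C) (A : D) :
    μ R X Y ▷ A ≫ cohopfLeft adj (X ⊗ Y) A ≫ R.map (α_ _ _ _).hom =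
      (α_ _ _ _).hom ≫ R.obj X ◁ cohopfLeft adj Y A ≫ μ R X (Y ⊗ U.obj A) := by
  simp only [cohopfLeft, Category.assoc, MonoidalCategory.whiskerLeft_comp]
  rw [← whisker_exchange_assoc, Functor.LaxMonoidal.associativity,
    associator_naturality_right_assoc]

theorem μ_comp_cohopfRight (A : D) (X Y : C) :
    A ◁ μ R X Y ≫ cohopfRight adj A (X ⊗ Y) ≫ R.map (α_ _ _ _).inv =
      (α_ _ _ _).inv ≫ cohopfRight adj A X ▷ R.obj Y ≫ μ R (U.obj A ⊗ X) Y := by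
  simp only [cohopfRight, Category.assoc, comp_whiskerRight]
  rw [whisker_exchange_assoc, Functor.LaxMonoidal.associativity_inv,
    associator_inv_naturality_left_assoc]

theorem cohopfRight_comp_cohopfLeft (A : D) (X : C) (B : D) :
    cohopfRight adj A X ▷ B ≫ cohopfLeft adj (U.obj A ⊗ X) B ≫ R.map (α_ _ _ _).hom =
      (α_ _ _ _).hom ≫ A ◁ cohopfLeft adj X B ≫ cohopfRight adj A (X ⊗ U.obj B) := by
  simp only [cohopfLeft, cohopfRight, Category.assoc, MonoidalCategory.whiskerLeft_comp,
    comp_whiskerRight]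
  rw [← whisker_exchange_assoc, ← whisker_exchange_assoc, Functor.LaxMonoidal.associativity,
    associator_naturality_left_assoc, associator_naturality_right_assoc,
    whisker_exchange_assoc, whisker_exchange_assoc, whisker_exchange_assoc]

variable [U.Monoidal] [adj.IsMonoidal]

theorem adjUnit_comp_cohopfLeft (A B : D) :
    adjUnit adj A ▷ B ≫ cohopfLeft adj (U.obj A) B =
      adjUnit adj (A ⊗ B) ≫ R.map (δ U A B) := by
  rw [adjUnit_tensor_comp_map_δ, MonoidalCategory.tensorHom_def, cohopfLeft, Category.assoc]

theorem adjUnit_comp_cohopfRight (A B : D) :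
    A ◁ adjUnit adj B ≫ cohopfRight adj A (U.obj B) =
      adjUnit adj (A ⊗ B) ≫ R.map (δ U A B) := by
  rw [adjUnit_tensor_comp_map_δ, MonoidalCategory.tensorHom_def', cohopfRight, Category.assoc]

/-- The transpose under `U ⊣ R`, dual to `adjUnit_comp_map_hopfLeft`. -/
theorem map_cohopfLeft_comp_adjCounit (X : C) (A : D) :
    U.map (cohopfLeft adj X A) ≫ adjCounit adj (X ⊗ U.obj A) =
      δ U (R.obj X) A ≫ adjCounit adj X ▷ U.obj A := by
  rw [cohopfLeft, Functor.map_comp, Category.assoc, map_μ_comp_adjCounit_tensor,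
    ← δ_natural_right_assoc, MonoidalCategory.tensorHom_def',
    ← MonoidalCategory.whiskerLeft_comp_assoc,
    map_adjUnit_comp_adjCounit, MonoidalCategory.whiskerLeft_id, Category.id_comp]

theorem map_cohopfRight_comp_adjCounit (A : D) (X : C) :
    U.map (cohopfRight adj A X) ≫ adjCounit adj (U.obj A ⊗ X) =
      δ U A (R.obj X) ≫ U.obj A ◁ adjCounit adj X := by
  rw [cohopfRight, Functor.map_comp, Category.assoc, map_μ_comp_adjCounit_tensor,
    ← δ_natural_left_assoc, MonoidalCategory.tensorHom_def, ← comp_whiskerRight_assoc,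
    map_adjUnit_comp_adjCounit, id_whiskerRight, Category.id_comp]

/-- Dual to `map_α_comp_hopfLeft_tensor`: the factors of `A ⊗ B` are absorbed one at a time, now by
associativity of `μ R`. -/
theorem cohopfLeft_tensor_comp_map_α (X : C) (A B : D) :
    cohopfLeft adj X (A ⊗ B) ≫ R.map (X ◁ δ U A B) ≫ R.map (α_ _ _ _).inv =
      (α_ _ _ _).inv ≫ cohopfLeft adj X A ▷ B ≫ cohopfLeft adj (X ⊗ U.obj A) B := by
  have h : cohopfLeft adj X A ▷ B =
      (R.obj X ◁ adjUnit adj A) ▷ B ≫ μ R X (U.obj A) ▷ B := by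
    rw [cohopfLeft, comp_whiskerRight]
  rw [← cancel_mono (R.map (α_ X (U.obj A) (U.obj B)).hom)]
  simp only [Category.assoc, h, μ_comp_cohopfLeft, associator_naturality_middle_assoc,
    Iso.inv_hom_id_assoc, ← MonoidalCategory.whiskerLeft_comp_assoc, adjUnit_comp_cohopfLeft]
  rw [MonoidalCategory.whiskerLeft_comp_assoc, μ_natural_right, cohopfLeft, Category.assoc,
    ← Functor.map_comp, Iso.inv_hom_id, CategoryTheory.Functor.map_id, Category.comp_id]

theorem cohopfRight_tensor_comp_map_α (A B : D) (X : C) :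
    cohopfRight adj (A ⊗ B) X ≫ R.map (δ U A B ▷ X) ≫ R.map (α_ _ _ _).hom =
      (α_ _ _ _).hom ≫ A ◁ cohopfRight adj B X ≫ cohopfRight adj A (U.obj B ⊗ X) := by
  have h : A ◁ cohopfRight adj B X =
      A ◁ (adjUnit adj B ▷ R.obj X) ≫ A ◁ μ R (U.obj B) X := by
    rw [cohopfRight, MonoidalCategory.whiskerLeft_comp]
  rw [← cancel_mono (R.map (α_ (U.obj A) (U.obj B) X).inv)]
  simp only [Category.assoc, h, μ_comp_cohopfRight, associator_inv_naturality_middle_assoc,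
    Iso.hom_inv_id_assoc, ← comp_whiskerRight_assoc, adjUnit_comp_cohopfRight]
  rw [comp_whiskerRight_assoc, μ_natural_left, cohopfRight, Category.assoc,
    ← Functor.map_comp, Iso.hom_inv_id, CategoryTheory.Functor.map_id, Category.comp_id]

theorem cohopfLeft_unit_comp_map_η (X : C) :
    (ρ_ _).inv ≫ cohopfLeft adj X (𝟙_ D) ≫ R.map (X ◁ η U) = R.map (ρ_ X).inv := by
  rw [cohopfLeft, Category.assoc, ← μ_natural_right, ← MonoidalCategory.whiskerLeft_comp_assoc,
    adjUnit_unit_comp_map_η, right_unitality_inv]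

theorem cohopfRight_unit_comp_map_η (X : C) :
    (λ_ _).inv ≫ cohopfRight adj (𝟙_ D) X ≫ R.map (η U ▷ X) = R.map (λ_ X).inv := by
  rw [cohopfRight, Category.assoc, ← μ_natural_left, ← comp_whiskerRight_assoc,
    adjUnit_unit_comp_map_η, left_unitality_inv]

theorem cohopfLeft_tensor (X : C) (A B : D) :
    (α_ _ _ _).hom ≫ cohopfLeft adj X (A ⊗ B) = cohopfLeft adj X A ▷ B ≫
      cohopfLeft adj (X ⊗ U.obj A) B ≫ R.map (α_ _ _ _).hom ≫ R.map (X ◁ μ U A B) := by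
  rw [← Iso.eq_inv_comp, ← reassoc_of% @cohopfLeft_tensor_comp_map_α, ← Functor.map_comp_assoc,
    ← Functor.map_comp, ← Functor.map_comp, Category.assoc, Iso.inv_hom_id_assoc,
    ← MonoidalCategory.whiskerLeft_comp, Functor.Monoidal.δ_μ]
  simp

theorem cohopfRight_tensor (A B : D) (X : C) :
    (α_ _ _ _).inv ≫ cohopfRight adj (A ⊗ B) X = A ◁ cohopfRight adj B X ≫
      cohopfRight adj A (U.obj B ⊗ X) ≫ R.map (α_ _ _ _).inv ≫ R.map (μ U A B ▷ X) := by
  rw [Iso.inv_comp_eq, ← reassoc_of% @cohopfRight_tensor_comp_map_α, ← Functor.map_comp_assoc,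
    ← Functor.map_comp, ← Functor.map_comp, Category.assoc, Iso.hom_inv_id_assoc,
    ← comp_whiskerRight, Functor.Monoidal.δ_μ]
  simp

theorem cohopfLeft_unit (X : C) :
    (ρ_ _).inv ≫ cohopfLeft adj X (𝟙_ D) = R.map (ρ_ X).inv ≫ R.map (X ◁ ε U) := by
  rw [← cohopfLeft_unit_comp_map_η adj X, Category.assoc, Category.assoc, ← Functor.map_comp,
    ← MonoidalCategory.whiskerLeft_comp, Functor.Monoidal.η_ε]
  simp

theorem cohopfRight_unit (X : C) :
    (λ_ _).inv ≫ cohopfRight adj (𝟙_ D) X = R.map (λ_ X).inv ≫ R.map (ε U ▷ X) := by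
  rw [← cohopfRight_unit_comp_map_η adj X, Category.assoc, Category.assoc, ← Functor.map_comp,
    ← comp_whiskerRight, Functor.Monoidal.η_ε]
  simp

end Right

end HopfOperators

/-! ### Strengths and costrengths from an adjoint triple with invertible Hopf operators. -/

section HopfTriple

variable {C : Type u₁} [Category.{v₁} C] [MonoidalCategory C]
  {D : Type u₂} [Category.{v₂} D] [MonoidalCategory D]
  {L : C ⥤ D} {U : D ⥤ C} {R : C ⥤ D} [L.OplaxMonoidal] [R.LaxMonoidal]
  (adjL : L ⊣ U) (adjR : U ⊣ R)

/-- In an adjoint triple `L ⊣ U ⊣ R` the Hopf operators of both adjunctions are invertible. -/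
class IsHopfTriple : Prop where
  hopfLeft (X : C) (A : D) : IsIso (hopfLeft adjL X A)
  hopfRight (A : D) (X : C) : IsIso (hopfRight adjL A X)
  cohopfLeft (X : C) (A : D) : IsIso (cohopfLeft adjR X A)
  cohopfRight (A : D) (X : C) : IsIso (cohopfRight adjR A X)

variable [H : IsHopfTriple adjL adjR]

/-- The costrength `L X ⊗ R Y ⟶ L (X ⊗ Y)` of a Hopf triple. -/
noncomputable def costrengthLeft (X Y : C) : L.obj X ⊗ R.obj Y ⟶ L.obj (X ⊗ Y) :=
  have := H.hopfLeft
  inv (hopfLeft adjL X (R.obj Y)) ≫ L.map (X ◁ adjCounit adjR Y)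

/-- The costrength `R X ⊗ L Y ⟶ L (X ⊗ Y)` of a Hopf triple. -/
noncomputable def costrengthRight (X Y : C) : R.obj X ⊗ L.obj Y ⟶ L.obj (X ⊗ Y) :=
  have := H.hopfRight
  inv (hopfRight adjL (R.obj X) Y) ≫ L.map (adjCounit adjR X ▷ Y)

/-- The strength `R (X ⊗ Y) ⟶ R X ⊗ L Y` of a Hopf triple. -/
noncomputable def strengthLeft (X Y : C) : R.obj (X ⊗ Y) ⟶ R.obj X ⊗ L.obj Y :=
  have := H.cohopfLeft
  R.map (X ◁ adjUnit adjL Y) ≫ inv (cohopfLeft adjR X (L.obj Y))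

/-- The strength `R (X ⊗ Y) ⟶ L X ⊗ R Y` of a Hopf triple. -/
noncomputable def strengthRight (X Y : C) : R.obj (X ⊗ Y) ⟶ L.obj X ⊗ R.obj Y :=
  have := H.cohopfRight
  R.map (adjUnit adjL X ▷ Y) ≫ inv (cohopfRight adjR (L.obj X) Y)

/-- As the Hopf operator is invertible, this equation determines the costrength. The axioms below
use it and its three analogues in place of the explicit inverses. -/
theorem hopfLeft_comp_costrengthLeft (X Y : C) :
    hopfLeft adjL X (R.obj Y) ≫ costrengthLeft adjL adjR X Y =
      L.map (X ◁ adjCounit adjR Y) := by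
  have := H.hopfLeft
  simp [costrengthLeft]

theorem hopfRight_comp_costrengthRight (X Y : C) :
    hopfRight adjL (R.obj X) Y ≫ costrengthRight adjL adjR X Y =
      L.map (adjCounit adjR X ▷ Y) := by
  have := H.hopfRight
  simp [costrengthRight]

theorem strengthLeft_comp_cohopfLeft (X Y : C) :
    strengthLeft adjL adjR X Y ≫ cohopfLeft adjR X (L.obj Y) =
      R.map (X ◁ adjUnit adjL Y) := by
  have := H.cohopfLeft
  simp [strengthLeft]

theorem strengthRight_comp_cohopfRight (X Y : C) :
    strengthRight adjL adjR X Y ≫ cohopfRight adjR (L.obj X) Y =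
      R.map (adjUnit adjL X ▷ Y) := by
  have := H.cohopfRight
  simp [strengthRight]

/-- By naturality of the Hopf operator, `f` enters only through its transpose under `U ⊣ R`. It is
applied with `f` equal to `ε R`, `μ R` or a unit, whose source need not be of the form `R Y`; this
is why the Hopf operators must be invertible at every object of `D`. -/
theorem hopfLeft_comp_whiskerLeft_costrengthLeft (X : C) {A : D} {Y : C} (f : A ⟶ R.obj Y) :
    hopfLeft adjL X A ≫ L.obj X ◁ f ≫ costrengthLeft adjL adjR X Y =
      L.map (X ◁ (U.map f ≫ adjCounit adjR Y)) := by
  rw [← reassoc_of% @hopfLeft_naturality_right, hopfLeft_comp_costrengthLeft, ← Functor.map_comp,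
    MonoidalCategory.whiskerLeft_comp]

theorem hopfRight_comp_whiskerRight_costrengthRight {A : D} {X : C} (f : A ⟶ R.obj X) (Y : C) :
    hopfRight adjL A Y ≫ f ▷ L.obj Y ≫ costrengthRight adjL adjR X Y =
      L.map ((U.map f ≫ adjCounit adjR X) ▷ Y) := by
  rw [← reassoc_of% @hopfRight_naturality_left, hopfRight_comp_costrengthRight, ← Functor.map_comp,
    comp_whiskerRight]

theorem strengthLeft_comp_whiskerLeft_cohopfLeft (X : C) {A : D} {Y : C} (f : L.obj Y ⟶ A) :
    strengthLeft adjL adjR X Y ≫ R.obj X ◁ f ≫ cohopfLeft adjR X A =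
      R.map (X ◁ (adjUnit adjL Y ≫ U.map f)) := by
  rw [cohopfLeft_naturality_right, reassoc_of% @strengthLeft_comp_cohopfLeft, ← Functor.map_comp,
    MonoidalCategory.whiskerLeft_comp]

theorem strengthRight_comp_whiskerRight_cohopfRight {A : D} {X : C} (f : L.obj X ⟶ A) (Y : C) :
    strengthRight adjL adjR X Y ≫ f ▷ R.obj Y ≫ cohopfRight adjR A Y =
      R.map ((adjUnit adjL X ≫ U.map f) ▷ Y) := by
  rw [cohopfRight_naturality_left, reassoc_of% @strengthRight_comp_cohopfRight, ← Functor.map_comp,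
    comp_whiskerRight]

variable [U.Monoidal]

/-- The defining equation of the strength, transposed under `U ⊣ R`. It no longer mentions the dual
Hopf operator and serves both the axiom `mix_Ll` and the counit of the final adjunction. -/
theorem map_strengthLeft_comp_adjCounit [adjR.IsMonoidal] (X Y : C) :
    U.map (strengthLeft adjL adjR X Y) ≫ δ U _ _ ≫ adjCounit adjR X ▷ U.obj (L.obj Y) =
      adjCounit adjR (X ⊗ Y) ≫ X ◁ adjUnit adjL Y := by
  rw [← map_cohopfLeft_comp_adjCounit, ← Functor.map_comp_assoc, strengthLeft_comp_cohopfLeft,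
    adjCounit_naturality]

theorem map_strengthRight_comp_adjCounit [adjR.IsMonoidal] (X Y : C) :
    U.map (strengthRight adjL adjR X Y) ≫ δ U _ _ ≫ U.obj (L.obj X) ◁ adjCounit adjR Y =
      adjCounit adjR (X ⊗ Y) ≫ adjUnit adjL X ▷ Y := by
  rw [← map_cohopfRight_comp_adjCounit, ← Functor.map_comp_assoc, strengthRight_comp_cohopfRight,
    adjCounit_naturality]

/-- The defining equation of the costrength, transposed under `L ⊣ U`; dual in role to
`map_strengthLeft_comp_adjCounit`. -/
theorem adjUnit_comp_map_costrengthLeft [adjL.IsMonoidal] (X Y : C) :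
    adjUnit adjL X ▷ U.obj (R.obj Y) ≫ μ U _ _ ≫ U.map (costrengthLeft adjL adjR X Y) =
      X ◁ adjCounit adjR Y ≫ adjUnit adjL (X ⊗ Y) := by
  rw [← reassoc_of% @adjUnit_comp_map_hopfLeft, ← Functor.map_comp, hopfLeft_comp_costrengthLeft,
    adjUnit_naturality]

theorem adjUnit_comp_map_costrengthRight [adjL.IsMonoidal] (X Y : C) :
    U.obj (R.obj X) ◁ adjUnit adjL Y ≫ μ U _ _ ≫ U.map (costrengthRight adjL adjR X Y) =
      adjCounit adjR X ▷ Y ≫ adjUnit adjL (X ⊗ Y) := by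
  rw [← reassoc_of% @adjUnit_comp_map_hopfRight, ← Functor.map_comp, hopfRight_comp_costrengthRight,
    adjUnit_naturality]

variable [adjL.IsMonoidal] [adjR.IsMonoidal]

/-- The strengths and costrengths of a Hopf triple `L ⊣ U ⊣ R` make `(R, L)` a linearly
distributive functor. -/
noncomputable def hopfTripleStructure : LinDistStructure R L :=
  have := H.hopfLeft
  have := H.hopfRight
  have := H.cohopfLeft
  have := H.cohopfRight
  { νRr := strengthRight adjL adjR
    νRl := strengthLeft adjL adjR
    νLr := costrengthRight adjL adjR
    νLl := costrengthLeft adjL adjR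
    νRr_natural f g := by
      rw [← cancel_mono (cohopfRight adjR _ _), MonoidalCategory.tensorHom_def',
        MonoidalCategory.tensorHom_def', Category.assoc, Category.assoc, Category.assoc,
        cohopfRight_naturality_left, reassoc_of% @cohopfRight_naturality_right,
        strengthRight_comp_cohopfRight, reassoc_of% @strengthRight_comp_cohopfRight]
      simp only [← Functor.map_comp]
      rw [Category.assoc, ← comp_whiskerRight, adjUnit_naturality, comp_whiskerRight,
        whisker_exchange_assoc]
    νRl_natural f g := by
      rw [← cancel_mono (cohopfLeft adjR _ _), MonoidalCategory.tensorHom_def,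
        MonoidalCategory.tensorHom_def, Category.assoc, Category.assoc, Category.assoc,
        cohopfLeft_naturality_right, reassoc_of% @cohopfLeft_naturality_left,
        strengthLeft_comp_cohopfLeft, reassoc_of% @strengthLeft_comp_cohopfLeft]
      simp only [← Functor.map_comp]
      rw [Category.assoc, ← MonoidalCategory.whiskerLeft_comp, adjUnit_naturality,
        MonoidalCategory.whiskerLeft_comp, whisker_exchange_assoc]
    νLr_natural f g := by
      rw [← cancel_epi (hopfRight adjL _ _), MonoidalCategory.tensorHom_def',
        MonoidalCategory.tensorHom_def', Category.assoc,
        ← reassoc_of% @hopfRight_naturality_right, ← reassoc_of% @hopfRight_naturality_left,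
        hopfRight_comp_costrengthRight, reassoc_of% @hopfRight_comp_costrengthRight]
      simp only [← Functor.map_comp, ← comp_whiskerRight, adjCounit_naturality,
        ← whisker_exchange_assoc]
    νLl_natural f g := by
      rw [← cancel_epi (hopfLeft adjL _ _), MonoidalCategory.tensorHom_def,
        MonoidalCategory.tensorHom_def, Category.assoc,
        ← reassoc_of% @hopfLeft_naturality_left, ← reassoc_of% @hopfLeft_naturality_right,
        hopfLeft_comp_costrengthLeft, reassoc_of% @hopfLeft_comp_costrengthLeft]
      simp only [← Functor.map_comp, ← MonoidalCategory.whiskerLeft_comp,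
        adjCounit_naturality, whisker_exchange_assoc]
    unit_Ll X := by
      rw [← cancel_epi (hopfLeft adjL _ _), reassoc_of% @hopfLeft_comp_whiskerLeft_costrengthLeft,
        map_ε_comp_adjCounit_unit, hopfLeft_unit]
    unit_Lr X := by
      rw [← cancel_epi (hopfRight adjL _ _),
        reassoc_of% @hopfRight_comp_whiskerRight_costrengthRight,
        map_ε_comp_adjCounit_unit, hopfRight_unit]
    unit_Rl X := by
      rw [← cancel_mono (cohopfLeft adjR _ _), Category.assoc, Category.assoc,
        strengthLeft_comp_whiskerLeft_cohopfLeft, adjUnit_unit_comp_map_η, cohopfLeft_unit]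
    unit_Rr X := by
      rw [← cancel_mono (cohopfRight adjR _ _), Category.assoc, Category.assoc,
        strengthRight_comp_whiskerRight_cohopfRight, adjUnit_unit_comp_map_η, cohopfRight_unit]
    act_Ll X Y Z := by
      -- Two costrengths occur in succession on the left, so two Hopf operators are cancelled.
      -- Together they form the operator at `R Y ⊗ R Z`, which clears the single costrength on the
      -- right.
      rw [← cancel_epi (hopfLeft adjL X (R.obj Y) ▷ R.obj Z),
        ← cancel_epi (hopfLeft adjL (X ⊗ U.obj (R.obj Y)) (R.obj Z)),
        ← comp_whiskerRight_assoc, hopfLeft_comp_costrengthLeft,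
        ← reassoc_of% @hopfLeft_naturality_left, reassoc_of% @hopfLeft_comp_costrengthLeft,
        ← reassoc_of% @map_α_comp_hopfLeft_tensor, hopfLeft_comp_whiskerLeft_costrengthLeft,
        map_μ_comp_adjCounit_tensor]
      simp only [← Functor.map_comp, ← MonoidalCategory.whiskerLeft_comp,
        Functor.Monoidal.μ_δ_assoc, MonoidalCategory.tensorHom_def]
      -- Both sides are now `L` of a morphism of `C`: each applies the counit of `U ⊣ R` in the last
      -- two factors and reassociates.
      congr 1
      simp
    act_Lr X Y Z := by
      -- The right Hopf operators end in `R X ⊗ (R Y ⊗ L Z)`, whereas the axiom starts from the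
      -- other bracketing; hence the associator.
      rw [← cancel_epi ((R.obj X ◁ hopfRight adjL (R.obj Y) Z) ≫ (α_ _ _ _).inv),
        ← cancel_epi (hopfRight adjL (R.obj X) (U.obj (R.obj Y) ⊗ Z)),
        Category.assoc, Category.assoc, Iso.inv_hom_id_assoc,
        ← reassoc_of% @map_α_comp_hopfRight_tensor,
        reassoc_of% @hopfRight_comp_whiskerRight_costrengthRight,
        ← MonoidalCategory.whiskerLeft_comp_assoc, hopfRight_comp_costrengthRight,
        ← reassoc_of% @hopfRight_naturality_right, hopfRight_comp_costrengthRight,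
        map_μ_comp_adjCounit_tensor]
      simp only [← Functor.map_comp, ← comp_whiskerRight_assoc,
        Functor.Monoidal.μ_δ_assoc, MonoidalCategory.tensorHom_def']
      congr 1
      simp
    act_Rl X Y Z := by
      -- The dual operator at `L Y ⊗ L Z` is cancelled in one piece; `cohopfLeft_tensor` splits it
      -- into two stages, one for each strength on the left.
      rw [← cancel_mono (cohopfLeft adjR _ _), Category.assoc, Category.assoc, Category.assoc,
        Category.assoc, cohopfLeft_tensor, strengthLeft_comp_whiskerLeft_cohopfLeft,
        adjUnit_tensor_comp_map_δ, ← comp_whiskerRight_assoc, strengthLeft_comp_cohopfLeft,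
        reassoc_of% @cohopfLeft_naturality_left, reassoc_of% @strengthLeft_comp_cohopfLeft]
      simp only [← Functor.map_comp]
      congr 1
      simp [MonoidalCategory.tensorHom_def']
    act_Rr X Y Z := by
      rw [← cancel_mono ((α_ _ _ _).inv ≫ cohopfRight adjR _ _), Category.assoc, Category.assoc,
        Category.assoc, Category.assoc, Iso.hom_inv_id_assoc, cohopfRight_tensor,
        strengthRight_comp_whiskerRight_cohopfRight,
        adjUnit_tensor_comp_map_δ, ← MonoidalCategory.whiskerLeft_comp_assoc,
        strengthRight_comp_cohopfRight,
        reassoc_of% @cohopfRight_naturality_right, reassoc_of% @strengthRight_comp_cohopfRight]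
      simp only [← Functor.map_comp]
      congr 1
      simp [MonoidalCategory.tensorHom_def]
    bi_L X Y Z := by
      -- Operators at both ends are cancelled; `hopfLeft_comp_hopfRight` reverses their order to
      -- suit the right-hand side.
      rw [← cancel_epi (hopfRight adjL (R.obj X) Y ▷ R.obj Z),
        ← cancel_epi (hopfLeft adjL (U.obj (R.obj X) ⊗ Y) (R.obj Z)),
        ← comp_whiskerRight_assoc, hopfRight_comp_costrengthRight,
        ← reassoc_of% @hopfLeft_naturality_left, reassoc_of% @hopfLeft_comp_costrengthLeft,
        reassoc_of% @hopfLeft_comp_hopfRight, ← MonoidalCategory.whiskerLeft_comp_assoc,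
        hopfLeft_comp_costrengthLeft, ← reassoc_of% @hopfRight_naturality_right,
        hopfRight_comp_costrengthRight]
      simp only [← Functor.map_comp]
      rw [associator_naturality_right, associator_naturality_left_assoc, whisker_exchange]
    bi_R X Y Z := by
      rw [← cancel_mono (L.obj X ◁ cohopfLeft adjR Y (L.obj Z)),
        ← cancel_mono (cohopfRight adjR (L.obj X) (Y ⊗ U.obj (L.obj Z)))]
      simp only [Category.assoc]
      rw [← cohopfRight_comp_cohopfLeft, ← comp_whiskerRight_assoc,
        strengthRight_comp_cohopfRight, reassoc_of% @cohopfLeft_naturality_left,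
        reassoc_of% @strengthLeft_comp_cohopfLeft, ← MonoidalCategory.whiskerLeft_comp_assoc,
        strengthLeft_comp_cohopfLeft, cohopfRight_naturality_right,
        reassoc_of% @strengthRight_comp_cohopfRight]
      simp only [← Functor.map_comp]
      rw [associator_naturality_left, associator_naturality_right_assoc, whisker_exchange]
    mix_Ll X Y Z := by
      -- Once `δ L` is rewritten through the unit, both sides end in the Hopf operator at `L Z`.
      -- What precedes it is `L` of `map_strengthLeft_comp_adjCounit` tensored with `X`, up to
      -- associators.
      rw [← cancel_epi (hopfLeft adjL X (R.obj (Y ⊗ Z))), ← reassoc_of% @hopfLeft_naturality_right,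
        reassoc_of% @hopfLeft_tensor, ← comp_whiskerRight, hopfLeft_comp_costrengthLeft,
        ← hopfLeft_naturality_left, reassoc_of% @hopfLeft_comp_costrengthLeft,
        ← map_adjUnit_comp_hopfLeft adjL]
      simp only [← Functor.map_comp_assoc, ← associator_inv_naturality_middle,
        ← associator_inv_naturality_right,
        ← MonoidalCategory.whiskerLeft_comp_assoc, map_strengthLeft_comp_adjCounit]
    mix_Lr X Y Z := by
      rw [← cancel_epi (hopfRight adjL (R.obj (X ⊗ Y)) Z), ← reassoc_of% @hopfRight_naturality_left,
        reassoc_of% @hopfRight_tensor, ← MonoidalCategory.whiskerLeft_comp,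
        hopfRight_comp_costrengthRight,
        ← hopfRight_naturality_right, reassoc_of% @hopfRight_comp_costrengthRight,
        ← map_adjUnit_comp_hopfRight adjL]
      simp only [← Functor.map_comp_assoc, ← associator_naturality_middle,
        ← associator_naturality_left,
        ← comp_whiskerRight_assoc, map_strengthRight_comp_adjCounit]
    mix_Rl X Y Z := by
      -- Dually to `mix_Ll`, both sides come to begin with the dual operator at `R Z`, and
      -- `adjUnit_comp_map_costrengthLeft` compares what follows.
      rw [← cancel_mono (cohopfLeft adjR X (L.obj (Y ⊗ Z)))]
      simp only [Category.assoc]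
      rw [cohopfLeft_naturality_right, reassoc_of% @cohopfLeft_tensor, ← comp_whiskerRight_assoc,
        strengthLeft_comp_cohopfLeft, reassoc_of% @cohopfLeft_naturality_left,
        strengthLeft_comp_cohopfLeft, ← cohopfLeft_comp_map_adjCounit adjR]
      simp only [← Functor.map_comp, associator_naturality_middle_assoc,
        associator_naturality_right_assoc, Category.assoc,
        ← MonoidalCategory.whiskerLeft_comp, adjUnit_comp_map_costrengthLeft]
    mix_Rr X Y Z := by
      rw [← cancel_mono (cohopfRight adjR (L.obj (X ⊗ Y)) Z)]
      simp only [Category.assoc]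
      rw [cohopfRight_naturality_left, reassoc_of% @cohopfRight_tensor,
        ← MonoidalCategory.whiskerLeft_comp_assoc,
        strengthRight_comp_cohopfRight, reassoc_of% @cohopfRight_naturality_right,
        strengthRight_comp_cohopfRight, ← cohopfRight_comp_map_adjCounit adjR]
      simp only [← Functor.map_comp, associator_inv_naturality_middle_assoc,
        associator_inv_naturality_left_assoc, Category.assoc,
        ← comp_whiskerRight, adjUnit_comp_map_costrengthRight]
    str_Ll X Y Z := by
      -- Each side contains a single costrength, so one Hopf operator and coassociativity are
      -- enough.
      rw [← cancel_epi (hopfLeft adjL (X ⊗ Y) (R.obj Z)), reassoc_of% @hopfLeft_comp_δ,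
        ← MonoidalCategory.whiskerLeft_comp, hopfLeft_comp_costrengthLeft,
        reassoc_of% @hopfLeft_comp_costrengthLeft, δ_natural_right]
      simp only [← Functor.map_comp_assoc, associator_naturality_right]
    str_Lr X Y Z := by
      rw [← cancel_epi (hopfRight adjL (R.obj X) (Y ⊗ Z)), reassoc_of% @hopfRight_comp_δ,
        ← comp_whiskerRight, hopfRight_comp_costrengthRight,
        reassoc_of% @hopfRight_comp_costrengthRight, δ_natural_left]
      simp only [← Functor.map_comp_assoc, associator_inv_naturality_left]
    str_Rl X Y Z := by
      rw [← cancel_mono (cohopfLeft adjR (X ⊗ Y) (L.obj Z) ≫ R.map (α_ _ _ _).hom)]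
      simp only [Category.assoc]
      rw [μ_comp_cohopfLeft, Iso.inv_hom_id_assoc, ← MonoidalCategory.whiskerLeft_comp_assoc,
        strengthLeft_comp_cohopfLeft, reassoc_of% @strengthLeft_comp_cohopfLeft, μ_natural_right,
        ← Functor.map_comp, ← Functor.map_comp, associator_naturality_right,
        Iso.inv_hom_id_assoc]
    str_Rr X Y Z := by
      rw [← cancel_mono (cohopfRight adjR (L.obj X) (Y ⊗ Z) ≫ R.map (α_ _ _ _).inv)]
      simp only [Category.assoc]
      rw [μ_comp_cohopfRight, Iso.hom_inv_id_assoc, ← comp_whiskerRight_assoc,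
        strengthRight_comp_cohopfRight, reassoc_of% @strengthRight_comp_cohopfRight, μ_natural_left,
        ← Functor.map_comp, ← Functor.map_comp, associator_inv_naturality_left,
        Iso.hom_inv_id_assoc] }

theorem isComonoidalTrans_unit : IsComonoidalTrans adjL.unit where
  counit := by
    change adjUnit adjL (𝟙_ C) ≫ U.map (η L) ≫ η U = 𝟙 (𝟙_ C)
    rw [reassoc_of% @adjUnit_unit_comp_map_η, Functor.Monoidal.ε_η]
  cotensor X Y := by
    change adjUnit adjL (X ⊗ Y) ≫ U.map (δ L X Y) ≫ δ U (L.obj X) (L.obj Y) =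
      𝟙 (X ⊗ Y) ≫ (adjUnit adjL X ⊗ₘ adjUnit adjL Y)
    rw [reassoc_of% @adjUnit_tensor_comp_map_δ, Functor.Monoidal.μ_δ, Category.comp_id,
      Category.id_comp]

theorem isComonoidalTrans_counit : IsComonoidalTrans adjL.counit where
  counit := by
    change adjCounit adjL (𝟙_ D) ≫ 𝟙 (𝟙_ D) = L.map (η U) ≫ η L
    rw [← map_ε_comp_adjCounit_unit adjL, ← Functor.map_comp_assoc, Functor.Monoidal.η_ε]
    simp
  cotensor A B := by
    change adjCounit adjL (A ⊗ B) ≫ 𝟙 (A ⊗ B) =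
      (L.map (δ U A B) ≫ δ L (U.obj A) (U.obj B)) ≫ (adjCounit adjL A ⊗ₘ adjCounit adjL B)
    rw [Category.assoc, ← map_μ_comp_adjCounit_tensor, ← Functor.map_comp_assoc,
      Functor.Monoidal.δ_μ]
    simp

/-- The unit of the adjunction `(U, U) ⊣ (R, L)` given by a Hopf triple `L ⊣ U ⊣ R`. -/
noncomputable def hopfTripleUnit :
    LinDistTrans (LinDistFunctor.id D)
      ((LinDistFunctor.ofMonoidal U).comp (LinDistFunctor.mk R L (hopfTripleStructure adjL adjR)))
      where
  ρ := adjR.unit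
  lam := adjL.counit
  monoidal := inferInstanceAs (NatTrans.IsMonoidal adjR.unit)
  comonoidal := isComonoidalTrans_counit adjL
  comp_Ll A B := by
    have := H.hopfLeft
    change L.obj (U.obj A) ◁ adjUnit adjR B ≫
      (costrengthLeft adjL adjR (U.obj A) (U.obj B) ≫ L.map (μ U A B)) ≫ adjCounit adjL (A ⊗ B) =
        adjCounit adjL A ▷ B ≫ 𝟙 (A ⊗ B)
    -- The Hopf operator is taken at the arbitrary object `B`: the unit of `U ⊣ R` transposes to an
    -- identity and only the maps of `L ⊣ U` remain.
    rw [← cancel_epi (hopfLeft adjL (U.obj A) B), Category.assoc,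
      reassoc_of% @hopfLeft_comp_whiskerLeft_costrengthLeft, map_adjUnit_comp_adjCounit,
      Category.comp_id, hopfLeft_comp_adjCounit]
    simp
  comp_Lr A B := by
    have := H.hopfRight
    change adjUnit adjR A ▷ L.obj (U.obj B) ≫
      (costrengthRight adjL adjR (U.obj A) (U.obj B) ≫ L.map (μ U A B)) ≫
        adjCounit adjL (A ⊗ B) = A ◁ adjCounit adjL B ≫ 𝟙 (A ⊗ B)
    rw [← cancel_epi (hopfRight adjL A (U.obj B)), Category.assoc,
      reassoc_of% @hopfRight_comp_whiskerRight_costrengthRight, map_adjUnit_comp_adjCounit,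
      Category.comp_id, hopfRight_comp_adjCounit]
    simp
  comp_Rl A B := by
    have := H.cohopfLeft
    change adjUnit adjR (A ⊗ B) ≫
      (R.map (δ U A B) ≫ strengthLeft adjL adjR (U.obj A) (U.obj B)) ≫
        R.obj (U.obj A) ◁ adjCounit adjL B = 𝟙 (A ⊗ B) ≫ adjUnit adjR A ▷ B
    rw [← cancel_mono (cohopfLeft adjR (U.obj A) B), Category.assoc, Category.assoc,
      Category.assoc, strengthLeft_comp_whiskerLeft_cohopfLeft, adjUnit_comp_map_adjCounit,
      Category.id_comp, adjUnit_comp_cohopfLeft]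
    simp
  comp_Rr A B := by
    have := H.cohopfRight
    change adjUnit adjR (A ⊗ B) ≫
      (R.map (δ U A B) ≫ strengthRight adjL adjR (U.obj A) (U.obj B)) ≫
        adjCounit adjL A ▷ R.obj (U.obj B) = 𝟙 (A ⊗ B) ≫ A ◁ adjUnit adjR B
    rw [← cancel_mono (cohopfRight adjR A (U.obj B)), Category.assoc, Category.assoc,
      Category.assoc, strengthRight_comp_whiskerRight_cohopfRight, adjUnit_comp_map_adjCounit,
      Category.id_comp, adjUnit_comp_cohopfRight]
    simp

/-- The counit of the adjunction `(U, U) ⊣ (R, L)` given by a Hopf triple `L ⊣ U ⊣ R`. -/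
noncomputable def hopfTripleCounit :
    LinDistTrans
      ((LinDistFunctor.mk R L (hopfTripleStructure adjL adjR)).comp (LinDistFunctor.ofMonoidal U))
      (LinDistFunctor.id C) where
  ρ := adjR.counit
  lam := adjL.unit
  monoidal := inferInstanceAs (NatTrans.IsMonoidal adjR.counit)
  comonoidal := isComonoidalTrans_unit adjL
  comp_Ll X Y := by
    -- The middle identity is the costrength of the identity functor.
    change X ◁ adjCounit adjR Y ≫ 𝟙 (X ⊗ Y) ≫ adjUnit adjL (X ⊗ Y) =
      adjUnit adjL X ▷ U.obj (R.obj Y) ≫ μ U (L.obj X) (R.obj Y) ≫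
        U.map (costrengthLeft adjL adjR X Y)
    rw [adjUnit_comp_map_costrengthLeft, Category.id_comp]
  comp_Lr X Y := by
    change adjCounit adjR X ▷ Y ≫ 𝟙 (X ⊗ Y) ≫ adjUnit adjL (X ⊗ Y) =
      U.obj (R.obj X) ◁ adjUnit adjL Y ≫ μ U (R.obj X) (L.obj Y) ≫
        U.map (costrengthRight adjL adjR X Y)
    rw [adjUnit_comp_map_costrengthRight, Category.id_comp]
  comp_Rl X Y := by
    change adjCounit adjR (X ⊗ Y) ≫ 𝟙 (X ⊗ Y) ≫ X ◁ adjUnit adjL Y =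
      (U.map (strengthLeft adjL adjR X Y) ≫ δ U (R.obj X) (L.obj Y)) ≫
        adjCounit adjR X ▷ U.obj (L.obj Y)
    rw [Category.assoc, map_strengthLeft_comp_adjCounit, Category.id_comp]
  comp_Rr X Y := by
    change adjCounit adjR (X ⊗ Y) ≫ 𝟙 (X ⊗ Y) ≫ adjUnit adjL X ▷ Y =
      (U.map (strengthRight adjL adjR X Y) ≫ δ U (L.obj X) (R.obj Y)) ≫
        U.obj (L.obj X) ◁ adjCounit adjR Y
    rw [Category.assoc, map_strengthRight_comp_adjCounit, Category.id_comp]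

end HopfTriple

/-! ### The adjunction in `MonLinDist`. -/

section Zigzag

open Bicategory

variable {B : Type u} [Bicategory.{w, v} B] {a b : B} {f : a ⟶ b} {g : b ⟶ a}

/-- Replaces the coherence-inserting composition by an explicit composite, whose components can be
computed by unfolding. -/
theorem leftZigzag_eq (φ : 𝟙 a ⟶ f ≫ g) (ψ : g ≫ f ⟶ 𝟙 b) :
    leftZigzag φ ψ = φ ▷ f ≫ (α_ f g f).hom ≫ f ◁ ψ := by
  simp [bicategoricalComp]

theorem rightZigzag_eq (φ : 𝟙 a ⟶ f ≫ g) (ψ : g ≫ f ⟶ 𝟙 b) :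
    rightZigzag φ ψ = g ◁ φ ≫ (α_ g f g).inv ≫ ψ ▷ g := by
  simp [bicategoricalComp]

end Zigzag

section HopfTripleAdjunction

variable {C D : Type u} [Category.{v} C] [MonoidalCategory C] [Category.{v} D]
  [MonoidalCategory D] {L : C ⥤ D} {U : D ⥤ C} {R : C ⥤ D} [L.OplaxMonoidal] [R.LaxMonoidal]
  [U.Monoidal] (adjL : L ⊣ U) (adjR : U ⊣ R) [adjL.IsMonoidal] [adjR.IsMonoidal]
  [IsHopfTriple adjL adjR]

/-- The adjunction `(U, U) ⊣ (R, L)` in `MonLinDist` given by a Hopf triple `L ⊣ U ⊣ R`. -/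
noncomputable def hopfTripleAdjunction :
    @Bicategory.Adjunction MonLinDist.{v, u} _ ⟨D⟩ ⟨C⟩ (LinDistFunctor.ofMonoidal U)
      (LinDistFunctor.mk R L (hopfTripleStructure adjL adjR)) where
  unit := hopfTripleUnit adjL adjR
  counit := hopfTripleCounit adjL adjR
  left_triangle := by
    rw [leftZigzag_eq]
    -- The `ρ` component is a triangle identity of `U ⊣ R`. As `lam` reverses composition, the `lam`
    -- component is the opposite triangle identity of `L ⊣ U`.
    apply LinDistTrans.ext
    · apply NatTrans.ext
      funext A
      change U.map (adjUnit adjR A) ≫ 𝟙 _ ≫ adjCounit adjR (U.obj A) = 𝟙 _ ≫ 𝟙 _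
      rw [Category.id_comp, map_adjUnit_comp_adjCounit, Category.comp_id]
    · apply NatTrans.ext
      funext A
      change (adjUnit adjL (U.obj A) ≫ 𝟙 _) ≫ U.map (adjCounit adjL A) = 𝟙 _ ≫ 𝟙 _
      rw [Category.comp_id, adjUnit_comp_map_adjCounit, Category.comp_id]
  right_triangle := by
    rw [rightZigzag_eq]
    apply LinDistTrans.ext
    · apply NatTrans.ext
      funext X
      change adjUnit adjR (R.obj X) ≫ 𝟙 _ ≫ R.map (adjCounit adjR X) = 𝟙 _ ≫ 𝟙 _
      rw [Category.id_comp, adjUnit_comp_map_adjCounit, Category.comp_id]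
    · apply NatTrans.ext
      funext X
      change (L.map (adjUnit adjL X) ≫ 𝟙 _) ≫ adjCounit adjL (L.obj X) = 𝟙 _ ≫ 𝟙 _
      rw [Category.comp_id, map_adjUnit_comp_adjCounit, Category.comp_id]

end HopfTripleAdjunction

/-! ### Invertibility descends from free, or from cofree, objects. -/

section Descent

variable {C : Type u₁} [Category.{v₁} C] {D : Type u₂} [Category.{v₂} D]
  {E : Type u₃} [Category.{v₃} E]

/-- The object `U A` is the split coequalizer of the two maps `U L U L U A ⟶ U L U A`. Any functor
on `C` preserves it, so an isomorphism at free objects induces one at `A`. The proof writes out the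
inverse, hence neither monadicity nor preservation of colimits is required. -/
theorem isIso_app_of_isIso_app_leftAdjoint {L : C ⥤ D} {U : D ⥤ C} (adj : L ⊣ U) {P Q : C ⥤ E}
    (φ : ∀ A : D, P.obj (U.obj A) ⟶ Q.obj (U.obj A))
    (hφ : ∀ {A B : D} (f : A ⟶ B), P.map (U.map f) ≫ φ B = φ A ≫ Q.map (U.map f))
    [∀ X : C, IsIso (φ (L.obj X))] (A : D) : IsIso (φ A) := by
  have hφ' (X : C) {B : D} (f : L.obj X ⟶ B) :
      inv (φ (L.obj X)) ≫ P.map (U.map f) ≫ φ B = Q.map (U.map f) := by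
    rw [hφ, IsIso.inv_hom_id_assoc]
  have hφ'' (X Y : C) (f : L.obj X ⟶ L.obj Y) :
      inv (φ (L.obj X)) ≫ P.map (U.map f) = Q.map (U.map f) ≫ inv (φ (L.obj Y)) := by
    rw [IsIso.eq_comp_inv, Category.assoc, hφ']
  have h : adjUnit adj (U.obj A) ≫ U.map (adjCounit adj A) = 𝟙 _ :=
    adjUnit_comp_map_adjCounit adj A
  -- The unit at `U A` splits `U` of the counit, so the candidate goes up to the free object,
  -- inverts there and comes back.
  refine ⟨Q.map (adjUnit adj (U.obj A)) ≫ inv (φ (L.obj (U.obj A))) ≫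
    P.map (U.map (adjCounit adj A)), ?_, ?_⟩
  -- The unit need not be the image under `U` of a morphism of `D`, so naturality of `φ` does not
  -- apply to it. Precomposing with the split epimorphism moves it to a free object, where only
  -- morphisms coming from `D` have to cross `φ`.
  · have : IsSplitEpi (U.map (adjCounit adj A)) := ⟨⟨_, h⟩⟩
    rw [← cancel_epi (P.map (U.map (adjCounit adj A))), reassoc_of% (hφ (adjCounit adj A)),
      ← Functor.map_comp_assoc, adjUnit_naturality, Functor.map_comp_assoc,
      ← reassoc_of% hφ'', ← Functor.map_comp, ← Functor.map_comp, adjCounit_naturality,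
      Functor.map_comp, Functor.map_comp, reassoc_of% hφ'', ← Functor.map_comp_assoc,
      adjUnit_comp_map_adjCounit]
    simp
  · rw [Category.assoc, Category.assoc, hφ', ← Functor.map_comp, h,
      CategoryTheory.Functor.map_id]

/-- Dual argument: `U A` is a split equalizer of objects in the image of `R ⋙ U`, with the counit at
`U A` as splitting. -/
theorem isIso_app_of_isIso_app_rightAdjoint {R : C ⥤ D} {U : D ⥤ C} (adj : U ⊣ R) {P Q : C ⥤ E}
    (φ : ∀ A : D, P.obj (U.obj A) ⟶ Q.obj (U.obj A))
    (hφ : ∀ {A B : D} (f : A ⟶ B), P.map (U.map f) ≫ φ B = φ A ≫ Q.map (U.map f))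
    [∀ X : C, IsIso (φ (R.obj X))] (A : D) : IsIso (φ A) := by
  have hφ' (X : C) {B : D} (f : B ⟶ R.obj X) :
      φ B ≫ Q.map (U.map f) ≫ inv (φ (R.obj X)) = P.map (U.map f) := by
    rw [← reassoc_of% (hφ f), IsIso.hom_inv_id, Category.comp_id]
  have hφ'' (X Y : C) (f : R.obj X ⟶ R.obj Y) :
      inv (φ (R.obj X)) ≫ P.map (U.map f) = Q.map (U.map f) ≫ inv (φ (R.obj Y)) := by
    rw [IsIso.eq_comp_inv, Category.assoc, hφ, IsIso.inv_hom_id_assoc]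
  have h : U.map (adjUnit adj A) ≫ adjCounit adj (U.obj A) = 𝟙 _ :=
    map_adjUnit_comp_adjCounit adj A
  refine ⟨Q.map (U.map (adjUnit adj A)) ≫ inv (φ (R.obj (U.obj A))) ≫
    P.map (adjCounit adj (U.obj A)), ?_, ?_⟩
  · rw [reassoc_of% hφ', ← Functor.map_comp, h,
      CategoryTheory.Functor.map_id]
  · have : IsSplitMono (U.map (adjUnit adj A)) := ⟨⟨_, h⟩⟩
    rw [← cancel_mono (Q.map (U.map (adjUnit adj A))), Category.assoc, Category.assoc,
      Category.assoc, ← hφ, ← Functor.map_comp_assoc, ← adjCounit_naturality,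
      Functor.map_comp_assoc, reassoc_of% hφ'', ← Functor.map_comp_assoc, ← Functor.map_comp,
      ← adjUnit_naturality, Functor.map_comp, Functor.map_comp_assoc, ← reassoc_of% hφ'',
      ← Functor.map_comp_assoc, map_adjUnit_comp_adjCounit]
    simp

end Descent

section HopfDescent

variable {C : Type u₁} [Category.{v₁} C] [MonoidalCategory C]
  {D : Type u₂} [Category.{v₂} D] [MonoidalCategory D]
  {L : C ⥤ D} {U : D ⥤ C} {R : C ⥤ D} [L.OplaxMonoidal] [R.LaxMonoidal]
  (adjL : L ⊣ U) (adjR : U ⊣ R) [U.Monoidal] [U.ReflectsIsomorphisms]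

theorem isIso_hopfLeft (h : ∀ X Y : C, IsIso (U.map (hopfLeft adjL X (L.obj Y)))) (X : C)
    (A : D) : IsIso (hopfLeft adjL X A) := by
  -- Appending the invertible `δ U` makes the target a functor of `U A`, as descent demands.
  have := isIso_app_of_isIso_app_leftAdjoint adjL (P := tensorLeft X ⋙ L ⋙ U)
    (Q := tensorLeft (U.obj (L.obj X))) (fun A => U.map (hopfLeft adjL X A) ≫ δ U (L.obj X) A)
    (fun f => by
      change U.map (L.map (X ◁ U.map f)) ≫ _ = _ ≫ _ ◁ U.map f
      rw [← Functor.map_comp_assoc, hopfLeft_naturality_right, Functor.map_comp_assoc,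
        ← δ_natural_right, Category.assoc]) A
  have := IsIso.of_isIso_comp_right (U.map (hopfLeft adjL X A)) (δ U (L.obj X) A)
  exact isIso_of_reflects_iso _ U

theorem isIso_hopfRight (h : ∀ X Y : C, IsIso (U.map (hopfRight adjL (L.obj X) Y))) (A : D)
    (X : C) : IsIso (hopfRight adjL A X) := by
  have := isIso_app_of_isIso_app_leftAdjoint adjL (P := tensorRight X ⋙ L ⋙ U)
    (Q := tensorRight (U.obj (L.obj X)))
    (fun A => U.map (hopfRight adjL A X) ≫ δ U A (L.obj X))
    (fun f => by
      change U.map (L.map (U.map f ▷ X)) ≫ _ = _ ≫ U.map f ▷ _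
      rw [← Functor.map_comp_assoc, hopfRight_naturality_left, Functor.map_comp_assoc,
        ← δ_natural_left, Category.assoc]) A
  have := IsIso.of_isIso_comp_right (U.map (hopfRight adjL A X)) (δ U A (L.obj X))
  exact isIso_of_reflects_iso _ U

theorem isIso_cohopfLeft (h : ∀ X Y : C, IsIso (U.map (cohopfLeft adjR X (R.obj Y)))) (X : C)
    (A : D) : IsIso (cohopfLeft adjR X A) := by
  have := isIso_app_of_isIso_app_rightAdjoint adjR (Q := tensorLeft X ⋙ R ⋙ U)
    (P := tensorLeft (U.obj (R.obj X))) (fun A => μ U (R.obj X) A ≫ U.map (cohopfLeft adjR X A))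
    (fun f => by
      change _ ◁ U.map f ≫ _ = _ ≫ U.map (R.map (X ◁ U.map f))
      rw [μ_natural_right_assoc, Category.assoc, ← Functor.map_comp, ← Functor.map_comp,
        cohopfLeft_naturality_right]) A
  have := IsIso.of_isIso_comp_left (μ U (R.obj X) A) (U.map (cohopfLeft adjR X A))
  exact isIso_of_reflects_iso _ U

theorem isIso_cohopfRight (h : ∀ X Y : C, IsIso (U.map (cohopfRight adjR (R.obj X) Y))) (A : D)
    (X : C) : IsIso (cohopfRight adjR A X) := by
  have := isIso_app_of_isIso_app_rightAdjoint adjR (Q := tensorRight X ⋙ R ⋙ U)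
    (P := tensorRight (U.obj (R.obj X)))
    (fun A => μ U A (R.obj X) ≫ U.map (cohopfRight adjR A X))
    (fun f => by
      change U.map f ▷ _ ≫ _ = _ ≫ U.map (R.map (U.map f ▷ X))
      rw [μ_natural_left_assoc, Category.assoc, ← Functor.map_comp, ← Functor.map_comp,
        cohopfRight_naturality_left]) A
  have := IsIso.of_isIso_comp_left (μ U A (R.obj X)) (U.map (cohopfRight adjR A X))
  exact isIso_of_reflects_iso _ U

end HopfDescent

/-! ### Underlying morphisms of the units and counits for `T`-algebras. -/

section FreeAlgebra

variable {C : Type u} [Category.{v} C] (T : Monad C)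

theorem adj_unit_app (X : C) : T.adj.unit.app X = T.η.app X :=
  Category.comp_id _

theorem adj_counit_f (A : T.Algebra) : (T.adj.counit.app A).f = A.a := by
  change T.map (𝟙 A.A) ≫ A.a = A.a
  simp

theorem adj_homEquiv_symm_f {X : C} {A : T.Algebra} (f : X ⟶ T.forget.obj A) :
    ((T.adj.homEquiv X A).symm f).f = T.map f ≫ A.a := by
  rw [Adjunction.homEquiv_counit, ← adj_counit_f]
  rfl

end FreeAlgebra

section CoinductionAction

variable {C : Type u} [Category.{v} C] (T : Monad C) {G : C ⥤ C} (adj : T.toFunctor ⊣ G)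

/-- The action on `G X` is the transpose of the comultiplication, which the counit of the comonad
cancels. -/
theorem coinduction_a_comp (X : C) :
    ((coinduction T adj).obj X).a ≫ (rightComonad T adj).ε.app X = adj.counit.app X := by
  have h := adj.counit_naturality ((rightCounit T adj).app X)
  have h' := (rightComonad T adj).right_counit X
  change (T.map ((rightComul T adj).app X) ≫ adj.counit.app (G.obj X)) ≫
    (rightCounit T adj).app X = _
  change (rightComul T adj).app X ≫ G.map ((rightCounit T adj).app X) = 𝟙 (G.obj X) at h'
  refine (Category.assoc _ _ _).trans ?_
  refine (congrArg (T.map ((rightComul T adj).app X) ≫ ·) h.symm).trans ?_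
  rw [← Functor.map_comp_assoc]
  refine (congrArg (fun k => T.map k ≫ adj.counit.app X) h').trans ?_
  simp

theorem forgetAdjCoinduction_homEquiv_f (A : T.Algebra) {X : C} (f : T.forget.obj A ⟶ X) :
    ((forgetAdjCoinduction T adj).homEquiv A X f).f = adj.homEquiv A.A X (A.a ≫ f) := by
  rw [Adjunction.homEquiv_unit]
  exact (adj.homEquiv_naturality_right A.a f).symm

/-- The unit at an algebra is the transpose of its action, and the action of `R^T X` is itself the
transpose of the comultiplication. -/
theorem adjUnit_coinduction_f (X : C) :
    (adjUnit (forgetAdjCoinduction T adj) ((coinduction T adj).obj X)).f =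
      (rightComonad T adj).δ.app X :=
  (congrArg (adj.homEquiv (G.obj X) (G.obj X)) (adj.homEquiv_counit _ _ _).symm).trans
    (Equiv.apply_symm_apply _ ((rightComul T adj).app X))

end CoinductionAction

/-! ### A biHopf monad yields a Hopf triple. -/

section BiHopfMonad

variable {C : Type u} [Category.{v} C] [MonoidalCategory C] (T : Monad C)
  [T.toFunctor.OplaxMonoidal] [IsComonoidalMonad T]

instance : T.adj.IsMonoidal :=
  inferInstanceAs (letI := T.adj.leftAdjointOplaxMonoidal; T.adj.IsMonoidal)

/-- The structure of the free functor is defined as a mate, namely `T (η ⊗ η)` followed by `δ` and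
`μ ⊗ μ`; naturality and a unit law of the monad collapse it. -/
theorem free_δ_f (X Y : C) : (δ T.free X Y).f = δ T.toFunctor X Y := by
  refine (adj_homEquiv_symm_f T ((T.adj.unit.app X ⊗ₘ T.adj.unit.app Y) ≫
    μ T.forget (T.free.obj X) (T.free.obj Y))).trans ?_
  refine (congrArg₂ (fun x y => T.map ((x ⊗ₘ y) ≫ 𝟙 (T.obj X ⊗ T.obj Y)) ≫
    δ T.toFunctor (T.obj X) (T.obj Y) ≫ (T.μ.app X ⊗ₘ T.μ.app Y)) (adj_unit_app T X)
      (adj_unit_app T Y)).trans ?_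
  rw [Category.comp_id, ← δ_natural_assoc, tensorHom_comp_tensorHom, T.right_unit, T.right_unit]
  simp

theorem free_η_f : (η T.free).f = η T.toFunctor := by
  refine (adj_homEquiv_symm_f T (ε T.forget)).trans ?_
  change T.map (𝟙 (𝟙_ C)) ≫ η T.toFunctor = _
  simp

/-- When `A` is free its action is the multiplication of `T`, so this is the left fusion operator.
-/
theorem forget_map_hopfLeft (X : C) (A : T.Algebra) :
    T.forget.map (hopfLeft T.adj X A) = δ T.toFunctor X A.A ≫ T.obj X ◁ A.a := by
  change (δ T.free X A.A).f ≫ (𝟙 (T.obj X) ⊗ₘ (T.adj.counit.app A).f) = _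
  rw [free_δ_f, adj_counit_f]
  exact congrArg (δ T.toFunctor X A.A ≫ ·) (id_tensorHom _ _)

theorem forget_map_hopfRight (A : T.Algebra) (X : C) :
    T.forget.map (hopfRight T.adj A X) = δ T.toFunctor A.A X ≫ A.a ▷ T.obj X := by
  change (δ T.free A.A X).f ≫ ((T.adj.counit.app A).f ⊗ₘ 𝟙 (T.obj X)) = _
  rw [free_δ_f, adj_counit_f]
  exact congrArg (δ T.toFunctor A.A X ≫ ·) (tensorHom_id _ _)

variable {G : C ⥤ C} (adj : T.toFunctor ⊣ G)

instance : (forgetAdjCoinduction T adj).IsMonoidal :=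
  inferInstanceAs (letI := (forgetAdjCoinduction T adj).rightAdjointLaxMonoidal
    (forgetAdjCoinduction T adj).IsMonoidal)

/-- Both structures are mates. Transposition under `U^T ⊣ R^T` is transposition under `T ⊣ G` after
composing with the tensor action, and `coinduction_a_comp` turns each factor into the counit of `T ⊣
G`. -/
theorem coinduction_μ_f (X Y : C) :
    (μ (coinduction T adj) X Y).f = μ (rightComonad T adj).toFunctor X Y := by
  refine (forgetAdjCoinduction_homEquiv_f T adj
    ((coinduction T adj).obj X ⊗ (coinduction T adj).obj Y) (δ T.forget _ _ ≫
      ((forgetAdjCoinduction T adj).counit.app X ⊗ₘ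
        (forgetAdjCoinduction T adj).counit.app Y))).trans ?_
  refine congrArg (adj.homEquiv (G.obj X ⊗ G.obj Y) (X ⊗ Y)) ?_
  -- The inserted identity is the structure map of the strict monoidal forgetful functor.
  have h {A B A' B' A'' B'' Z : C} (d : Z ⟶ A ⊗ B) (a : A ⟶ A') (b : B ⟶ B') (a' : A' ⟶ A'')
      (b' : B' ⟶ B'') :
      (d ≫ (a ⊗ₘ b)) ≫ 𝟙 (A' ⊗ B') ≫ (a' ⊗ₘ b') = d ≫ (a ≫ a' ⊗ₘ b ≫ b') := by simp
  refine (h (δ T.toFunctor (G.obj X) (G.obj Y)) _ _ _ _).trans ?_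
  exact congrArg₂ (fun x y => δ T.toFunctor (G.obj X) (G.obj Y) ≫ (x ⊗ₘ y))
    (coinduction_a_comp T adj X) (coinduction_a_comp T adj Y)

theorem coinduction_ε_f :
    (ε (coinduction T adj)).f = ε (rightComonad T adj).toFunctor := by
  refine (forgetAdjCoinduction_homEquiv_f T adj (𝟙_ T.Algebra) (η T.forget)).trans ?_
  exact congrArg (adj.homEquiv (𝟙_ C) (𝟙_ C)) (Category.comp_id (η T.toFunctor))

theorem forget_map_cohopfLeft (X Y : C) :
    T.forget.map (cohopfLeft (forgetAdjCoinduction T adj) X ((coinduction T adj).obj Y)) =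
      leftCofusion (rightComonad T adj) X Y := by
  change (𝟙 (G.obj X) ⊗ₘ
    (adjUnit (forgetAdjCoinduction T adj) ((coinduction T adj).obj Y)).f) ≫
      (μ (coinduction T adj) X (G.obj Y)).f = _
  rw [adjUnit_coinduction_f, coinduction_μ_f]
  exact congrArg (· ≫ μ (rightComonad T adj).toFunctor X (G.obj Y)) (id_tensorHom _ _)

theorem forget_map_cohopfRight (X Y : C) :
    T.forget.map (cohopfRight (forgetAdjCoinduction T adj) ((coinduction T adj).obj X) Y) =
      rightCofusion (rightComonad T adj) X Y := by
  change ((adjUnit (forgetAdjCoinduction T adj) ((coinduction T adj).obj X)).f ⊗ₘ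
    𝟙 (G.obj Y)) ≫ (μ (coinduction T adj) (G.obj X) Y).f = _
  rw [adjUnit_coinduction_f, coinduction_μ_f]
  exact congrArg (· ≫ μ (rightComonad T adj).toFunctor (G.obj X) Y) (tensorHom_id _ _)

theorem IsBiHopfMonad.isHopfTriple (h : IsBiHopfMonad T adj) :
    IsHopfTriple T.adj (forgetAdjCoinduction T adj) where
  hopfLeft := isIso_hopfLeft _ fun X Y => by
    rw [forget_map_hopfLeft]; exact h.hopf.left X Y
  hopfRight := isIso_hopfRight _ fun X Y => by
    rw [forget_map_hopfRight]; exact h.hopf.right X Y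
  cohopfLeft := isIso_cohopfLeft _ fun X Y => by
    rw [forget_map_cohopfLeft]; exact h.coHopf.left X Y
  cohopfRight := isIso_cohopfRight _ fun X Y => by
    rw [forget_map_cohopfRight]; exact h.coHopf.right X Y

end BiHopfMonad

/-! ### Components of the induced comultiplication. -/

section InducedComonad

variable {C D : Type u} [Category.{v} C] [MonoidalCategory C] [Category.{v} D]
  [MonoidalCategory D] {L : C ⥤ D} {U : D ⥤ C} {R : C ⥤ D} [L.OplaxMonoidal] [R.LaxMonoidal]
  [U.Monoidal] (adjL : L ⊣ U) (adjR : U ⊣ R) [adjL.IsMonoidal] [adjR.IsMonoidal]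
  [IsHopfTriple adjL adjR]

theorem inducedComul_hopfTripleAdjunction_ρ_app (X : C) :
    (LinDistTrans.ρ (inducedComul (hopfTripleAdjunction adjL adjR))).app X =
      U.map (adjUnit adjR (R.obj X)) := by
  change 𝟙 _ ≫ U.map (adjUnit adjR (R.obj X)) ≫ 𝟙 _ ≫ 𝟙 _ = _
  simp

theorem inducedComul_hopfTripleAdjunction_lam_app (X : C) :
    (LinDistTrans.lam (inducedComul (hopfTripleAdjunction adjL adjR))).app X =
      U.map (adjCounit adjL (L.obj X)) := by
  change ((𝟙 _ ≫ 𝟙 _) ≫ U.map (adjCounit adjL (L.obj X))) ≫ 𝟙 _ = _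
  simp

end InducedComonad

/-! ### Transport of the comonad to `(G, T)`. -/

section Transport

theorem isComonadHom_id {B : Type u} [Bicategory.{w, v} B] {a : B} {t : a ⟶ a}
    (K : Bicategory.Comonad t) : IsComonadHom K K (𝟙 t) :=
  ⟨by simp, by simp⟩

variable {C : Type u} [Category.{v} C] [MonoidalCategory C]

/-- A comonad in `MonLinDist` may be transported along equalities of the monoidal and comonoidal
structures of the underlying functors. -/
theorem exists_comonad_of_eq {R L : C ⥤ C} {i i' : R.LaxMonoidal} {j j' : L.OplaxMonoidal}
    (hi : i = i') (hj : j = j') (s : @LinDistStructure C _ _ C _ _ R L i j)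
    (K : @Bicategory.Comonad MonLinDist.{v, u} _ ⟨C⟩ (@LinDistFunctor.mk C _ _ C _ _ R L i j s)) :
    ∃ (t : @LinDistStructure C _ _ C _ _ R L i' j')
      (K' : @Bicategory.Comonad MonLinDist.{v, u} _ ⟨C⟩
        (@LinDistFunctor.mk C _ _ C _ _ R L i' j' t))
      (θ : @LinDistFunctor.mk C _ _ C _ _ R L i' j' t ≅ @LinDistFunctor.mk C _ _ C _ _ R L i j s),
      LinDistTrans.ρ θ.hom = 𝟙 R ∧ LinDistTrans.lam θ.hom = 𝟙 L ∧ IsComonadHom K' K θ.hom := by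
  -- After the substitution both pairs coincide and `θ` is the identity; its components are recorded
  -- because `t` and `K` are otherwise hidden by the existential.
  subst hi hj
  exact ⟨s, K, Iso.refl _, rfl, rfl, isComonadHom_id K⟩

variable (T : Monad C) [T.toFunctor.OplaxMonoidal] [IsComonoidalMonad T] {G : C ⥤ C}
  (adj : T.toFunctor ⊣ G)

/-- The underlying functors agree by definition, but the composite structure and the mate structure
on `G` agree only by a proof; hence the transport. -/
theorem coinduction_comp_forget_laxMonoidal :
    Functor.LaxMonoidal.comp (coinduction T adj) T.forget = adj.rightAdjointLaxMonoidal := by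
  apply Functor.LaxMonoidal.ext
  · exact (Category.id_comp _).trans (coinduction_ε_f T adj)
  · funext X Y
    exact (Category.id_comp _).trans (coinduction_μ_f T adj X Y)

theorem free_comp_forget_oplaxMonoidal :
    Functor.OplaxMonoidal.comp T.free T.forget = ‹T.toFunctor.OplaxMonoidal› := by
  apply Functor.OplaxMonoidal.ext
  · exact (Category.comp_id _).trans (free_η_f T)
  · funext X Y
    exact (Category.comp_id _).trans (free_δ_f T X Y)

end Transport

/-! ### The corollary for biHopf monads. -/

theorem mainTheorem7 {C : Type (max u v)} [Category.{v} C] [MonoidalCategory C] (T : Monad C)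
    [T.toFunctor.OplaxMonoidal] [IsComonoidalMonad T] {G : C ⥤ C} (adj : T.toFunctor ⊣ G)
    (hT : IsBiHopfMonad T adj) :
    ∃ (s : LinDistStructure (coinduction T adj) T.free)
      (A : Bicategory.Adjunction (forgetPair T) (coinductionFreePair T adj s))
      (t : LinDistStructure (rightComonad T adj).toFunctor T.toFunctor)
      (K : Bicategory.Comonad (comonadMonadPair T adj t))
      (θ : comonadMonadPair T adj t ≅
        CategoryStruct.comp (coinductionFreePair T adj s) (forgetPair T)),
      (LinDistTrans.ρ A.unit = (forgetAdjCoinduction T adj).unit ∧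
        LinDistTrans.lam A.unit = T.adj.counit ∧
        LinDistTrans.ρ A.counit = (forgetAdjCoinduction T adj).counit ∧
        LinDistTrans.lam A.counit = T.adj.unit) ∧
      (LinDistTrans.ρ K.counit = (rightComonad T adj).ε ∧
        LinDistTrans.lam K.counit = T.η ∧
        LinDistTrans.ρ K.comul = (rightComonad T adj).δ ∧
        LinDistTrans.lam K.comul = T.μ) ∧
      (∀ X : C, (LinDistTrans.ρ θ.hom).app X = 𝟙 (G.obj X)) ∧
      (∀ X : C, (LinDistTrans.lam θ.hom).app X = 𝟙 (T.obj X)) ∧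
      IsComonadHom K (inducedComonad A) θ.hom := by
  have := hT.isHopfTriple
  let A := hopfTripleAdjunction T.adj (forgetAdjCoinduction T adj)
  obtain ⟨t, K, θ, hρ, hlam, hθ⟩ := exists_comonad_of_eq (R := G) (L := T.toFunctor)
    (coinduction_comp_forget_laxMonoidal T adj)
    (free_comp_forget_oplaxMonoidal T)
    ((hopfTripleStructure T.adj (forgetAdjCoinduction T adj)).comp
      (LinDistStructure.ofMonoidal T.forget)) (inducedComonad A)
  have hρ' (X : C) : (LinDistTrans.ρ θ.hom).app X = 𝟙 (G.obj X) := by rw [hρ]; rfl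
  have hlam' (X : C) : (LinDistTrans.lam θ.hom).app X = 𝟙 (T.obj X) := by rw [hlam]; rfl
  -- The transported `K` is known only through `θ`. Since `θ` has identity components, the equations
  -- in `hθ` recover its counit and comultiplication from those of the induced comonad.
  refine ⟨_, A, t, K, θ, ⟨rfl, rfl, rfl, rfl⟩, ⟨?_, ?_, ?_, ?_⟩, hρ', hlam', hθ⟩
  · apply NatTrans.ext
    funext X
    have h := congrArg (fun k => (LinDistTrans.ρ k).app X) hθ.counit
    change (LinDistTrans.ρ θ.hom).app X ≫ (rightComonad T adj).ε.app X = _ at h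
    rw [hρ'] at h
    exact h.symm.trans (Category.id_comp _)
  · apply NatTrans.ext
    funext X
    have h := congrArg (fun k => (LinDistTrans.lam k).app X) hθ.counit
    change T.adj.unit.app X ≫ (LinDistTrans.lam θ.hom).app X = _ at h
    rw [hlam'] at h
    exact h.symm.trans ((Category.comp_id _).trans (adj_unit_app T X))
  · apply NatTrans.ext
    funext X
    have h := congrArg (fun k => (LinDistTrans.ρ k).app X) hθ.comul
    -- The last two factors on the right are the components of `θ ▷ t` and `t' ◁ θ`, both identities
    -- here.
    change (LinDistTrans.ρ θ.hom).app X ≫ (LinDistTrans.ρ (inducedComul A)).app X =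
      (LinDistTrans.ρ K.comul).app X ≫ G.map ((LinDistTrans.ρ θ.hom).app X) ≫
        (LinDistTrans.ρ θ.hom).app (G.obj X) at h
    rw [hρ', hρ', inducedComul_hopfTripleAdjunction_ρ_app] at h
    refine Eq.trans ?_ (h.symm.trans ((Category.id_comp _).trans (adjUnit_coinduction_f T adj X)))
    rw [CategoryTheory.Functor.map_id]
    exact ((congrArg (_ ≫ ·) (Category.comp_id _)).trans (Category.comp_id _)).symm
  · apply NatTrans.ext
    funext X
    have h := congrArg (fun k => (LinDistTrans.lam k).app X) hθ.comul
    -- All composites are reversed in the `lam` component, so the comultiplication of `K` comes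
    -- last; the induced one is the action on a free algebra, that is, the multiplication of `T`.
    change (LinDistTrans.lam (inducedComul A)).app X ≫ (LinDistTrans.lam θ.hom).app X =
      ((LinDistTrans.lam θ.hom).app (T.obj X) ≫ T.map ((LinDistTrans.lam θ.hom).app X)) ≫
        (LinDistTrans.lam K.comul).app X at h
    rw [hlam', hlam', inducedComul_hopfTripleAdjunction_lam_app] at h
    refine Eq.trans ?_ (h.symm.trans ((Category.comp_id _).trans
      (adj_counit_f T (T.free.obj X))))
    rw [CategoryTheory.Functor.map_id]
    exact ((congrArg (· ≫ _) (Category.comp_id _)).trans (Category.id_comp _)).symm
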